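/- **Setting.** Let $\mathbb{CP}^2$ carry its complex orientation and the Fubini–Study metric $g_N$ of scalar curvature $6$. Let $X=\Lambda^2_-(\mathbb{CP}^2)$, with Euclidean structure on the fibres for which the 2-forms $e^{12}-e^{34}$ ($e^i$ an oriented $g_N$-orthonormal coframe) have length one, and let $s$ be the Euclidean distance to the zero section along the fibres. Equip $X$ with the Bryant–Salamon $G_2$-structure with metric $f^2 g_{\mathbb{R}^3}+f^{-2}g_N$, $f=(1+s^2)^{-1/4}$, and 4-form $$\psi=\ast\varphi= f^{-4}\,\mathrm{vol}_N + Dy_2\wedge Dy_3\wedge\omega_1+Dy_3\wedge Dy_1\wedge\omega_2+Dy_1\wedge Dy_2\wedge\omega_3 ,$$ where $Z_1,Z_2,Z_3$ is a local oriented orthonormal frame of $\Lambda^2_-(\mathbb{CP}^2)$, $y_i$ are the fibre coordinates, $Dy_i$ their Levi-Civita covariant derivatives and $\omega_i$ is the 2-form $Z_i$ pulled back to $X$. (Here $\Lambda^2_-$ is identified with the traceless Hermitian endomorphisms of the orthogonal complement of the tautological line, $Y\mapsto 4\,\mathrm{Im}\,\mathrm{tr}(Y\,\cdot\,\cdot)$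 on tangent vectors of the space of rank one projections, and is oriented by the Pauli matrices.) The complement of the zero section in $X$ is $\mathbb{R}^+\times SU(3)/U(1)^2$, the projection to $\mathbb{CP}^2$ being $(s,g)\mapsto$ the line of $ge_0$. Let $\alpha_2=\theta_1-\theta_2$ be the root of $SU(3)$ belonging to the fibres $\mathbb{CP}^1$ of $SU(3)/U(1)^2\to\mathbb{CP}^2$, and let $P_{\alpha_2}=SU(3)\times_{(e^{\alpha_2},U(1)^2)}SO(3)$, pulled back to $\mathbb{R}^+\times SU(3)/U(1)^2$. Let $T_1,T_2,T_3$ be the basis of $\mathfrak{so}(3)\cong\mathfrak{su}(2)$ given by $i$ times the Pauli matrices, so $[T_i,T_j]=-2T_k$ for cyclic $(i,j,k)$, with $U(1)\subset SO(3)$ generated by $T_1$. Write the entries of the Maurer–Cartan form of $SU(3)$ as $\mu_{ab}$ ($a,b=0,1,2$) and put $$\alpha=\tfrac12\,\mathrm{Im}(\mu_{11}-\mu_{22})\otimes T_1,\quad \nu_1=\mathrm{Im}\,\mu_{12},\quad \nu_2=\mathrm{Re}\,\mu_{12},\quad \mu_{10}=e^1+ie^2,\quad \mu_{20}=e^3+ie^4,$$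 $$\Omega_1=-(e^{12}-e^{34}),\qquad \Omega_2=-(e^{14}-e^{23}),\qquad \Omega_3=e^{13}-e^{42},$$ so that $\sum_i\Omega_i\otimes T_i$ is the curvature of the connection $\alpha+\nu_1\otimes T_2+\nu_2\otimes T_3$ induced by the Levi-Civita connection on $\Lambda^2_-(\mathbb{CP}^2)$. **Theorem.** For each choice of sign, $P_{\alpha_2}$ extends across the zero section to an $SO(3)$-bundle over all of $X=\Lambda^2_-(\mathbb{CP}^2)$, namely the pull-back of the frame bundle of $\Lambda^2_-(\mathbb{CP}^2)$, by means of an isomorphism over the complement of the zero section (which may depend on the sign) for which the connection $$A=\alpha\pm(1+s^2)^{-\frac12}\left(\nu_1\otimes T_2+\nu_2\otimes T_3\right)$$ extends to a smooth connection over $X$. The connection $A$ is an irreducible $G_2$-instanton: its holonomy group is all of $SO(3)$, and $F_A\wedge\psi=0$ on $X$. Its curvature is, on $\mathbb{R}^+\times SU(3)$, $$F_A=\frac{2s^2}{s^2+1}\,\nu_{12}\otimes T_1+\Omega_1\otimes T_1\pm\frac{1}{\sqrt{s^2+1}}\left(\Omega_2\otimes T_2+\Omega_3\otimes T_3\right)\mp\frac{s}{(1+s^2)^{3/2}}\left(ds\wedge\nu_1\otimes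 T_2+ds\wedge\nu_2\otimes T_3\right),$$ where $\nu_{12}=\nu_1\wedge\nu_2$. -/

import Mathlib

open scoped ContDiff Matrix Matrix.Norms.L2Operator

namespace BSInstanton

/-! ### Submanifolds of a vector space

All manifolds below are smooth embedded submanifolds of finite-dimensional real vector spaces.
A smooth form on such a submanifold is represented by a form on the ambient space which is smooth
near the submanifold and which is only ever evaluated on tangent vectors; its exterior derivative
is the restriction of the ambient exterior derivative. -/

/-- The tangent vectors of a subset `S` of a normed space at `x`: velocities of curves in `S`. -/
def tangentVectors {E : Type*} [NormedAddCommGroup E] [NormedSpace ℝ E] (S : Set E) (x : E) :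
    Set E :=
  {v | ∃ γ : ℝ → E, (∀ t, γ t ∈ S) ∧ γ 0 = x ∧ HasDerivAt γ v 0}

/-- Complex 3 × 3 matrices, as a real vector space. -/
abbrev CMat := Matrix (Fin 3) (Fin 3) ℂ

/-- Real 3 × 3 matrices. -/
abbrev RMat := Matrix (Fin 3) (Fin 3) ℝ

/-! ### The projective plane with its Fubini–Study structure -/

/-- `ℂℙ²`: a line in `ℂ³` is represented by the orthogonal projection onto it. -/
def CP2 : Set CMat := {Q | Q.IsHermitian ∧ Q * Q = Q ∧ Q.trace = 1}

/-- The Fubini–Study metric with holomorphic sectional curvature `1`, i.e. scalar curvature `6`. -/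
noncomputable def fsMetric (U V : CMat) : ℝ := 2 * (U * V).trace.re

/-- The Kähler form `ω(U, V) = g(J U, V)` of `fsMetric`, at the point `Q`. -/
noncomputable def fsKahler (Q U V : CMat) : ℝ := 4 * (Q * U * V).trace.im

/-- The volume form `ω ∧ ω / 2` of `fsMetric` in the complex orientation, at the point `Q`. -/
noncomputable def fsVolume (Q : CMat) (U : Fin 4 → CMat) : ℝ :=
  fsKahler Q (U 0) (U 1) * fsKahler Q (U 2) (U 3)
    - fsKahler Q (U 0) (U 2) * fsKahler Q (U 1) (U 3)
    + fsKahler Q (U 0) (U 3) * fsKahler Q (U 1) (U 2)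

/-! ### The bundle `Λ²₋(ℂℙ²)` -/

/-- The anti-self-dual 2-form on `T_Q ℂℙ²` determined by a traceless Hermitian endomorphism `Y` of
the orthogonal complement of the line `Q`. By `isAntiSelfDual_iff` below, all anti-self-dual
2-forms at `Q` arise in this way from exactly one `Y`. -/
noncomputable def asdForm (Y U V : CMat) : ℝ := 4 * (Y * U * V).trace.im

/-- The fibre of `Λ²₋(ℂℙ²)` over `Q`: the 2-form `asdForm Y` is encoded by `Y`, a traceless
Hermitian endomorphism of the orthogonal complement of the line `Q`. -/
def LambdaMinus (Q : CMat) : Set CMat := {Y | Y.IsHermitian ∧ Y * Q = 0 ∧ Y.trace = 0}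

/-- The total space `X = Λ²₋(ℂℙ²)`. -/
def X : Set (CMat × CMat) := {x | x.1 ∈ CP2 ∧ x.2 ∈ LambdaMinus x.1}

/-- A bilinear form is (on `T_Q ℂℙ²`) an anti-self-dual 2-form: it is alternating and
`B(e₁, e₂) = - B(e₃, e₄)` for every positively oriented orthonormal basis. -/
def IsAntiSelfDual (Q : CMat) (B : CMat →ₗ[ℝ] CMat →ₗ[ℝ] ℝ) : Prop :=
  (∀ U ∈ tangentVectors CP2 Q, B U U = 0) ∧
  ∀ e : Fin 4 → CMat, (∀ i, e i ∈ tangentVectors CP2 Q) →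
    (∀ i j, fsMetric (e i) (e j) = if i = j then 1 else 0) → fsVolume Q e = 1 →
    B (e 0) (e 1) + B (e 2) (e 3) = 0


/-- The tangent space of `ℂℙ²` at `Q`, by its linear equations. -/
theorem mem_tangentVectors_CP2 {Q : CMat} (hQ : Q ∈ CP2) {U : CMat} :
    U ∈ tangentVectors CP2 Q ↔ U.IsHermitian ∧ Q * U + U * Q = U := by
  obtain ⟨hH, hI, hT⟩ := hQ
  constructor
  · rintro ⟨γ, hγ, h0, hd⟩
    constructor
    · let L : CMat →ₗ[ℝ] CMat := (Matrix.conjTransposeLinearEquiv (Fin 3) (Fin 3) ℝ ℂ).toLinearMap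
      have h1 : HasDerivAt (fun t => (γ t)ᴴ) Uᴴ 0 :=
        (LinearMap.toContinuousLinearMap L).hasFDerivAt.comp_hasDerivAt 0 hd
      have h2 : (fun t => (γ t)ᴴ) = γ := funext fun t => (hγ t).1
      rw [h2] at h1
      exact h1.unique hd
    · have h1 := hd.mul hd
      have h2 : (γ * γ) = γ := funext fun t => (hγ t).2.1
      rw [h2, h0] at h1
      rw [add_comm]; exact h1.unique hd
  · rintro ⟨hU, hE⟩
    have hz : Q * U * Q = 0 := by
      have h := congrArg (fun M => Q * M) hE
      simp only [mul_add, ← mul_assoc, hI] at h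
      simpa using h
    set ξ : CMat := U * Q - Q * U with hξ
    have hsk : ξᴴ = -ξ := by
      simp [hξ, Matrix.conjTranspose_sub, Matrix.conjTranspose_mul, hU.eq, hH.eq]
    have hstar : ∀ t : ℝ, (NormedSpace.exp (t • ξ))ᴴ = NormedSpace.exp (t • -ξ) := by
      intro t
      rw [← Matrix.exp_conjTranspose, Matrix.conjTranspose_smul, hsk]; simp
    have hinv : ∀ t : ℝ, NormedSpace.exp (t • -ξ) * NormedSpace.exp (t • ξ) = 1 := by
      intro t
      rw [← Matrix.exp_add_of_commute]
      · simp
      · simp only [smul_neg]; exact (Commute.refl _).neg_left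
    refine ⟨fun t => NormedSpace.exp (t • ξ) * Q * NormedSpace.exp (t • -ξ), ?_, by simp, ?_⟩
    · intro t
      have hi := hinv t
      refine ⟨?_, ?_, ?_⟩
      · have h2 : (NormedSpace.exp (t • -ξ))ᴴ = NormedSpace.exp (t • ξ) := by
          rw [← hstar, Matrix.conjTranspose_conjTranspose]
        show _ᴴ = _
        rw [Matrix.conjTranspose_mul, Matrix.conjTranspose_mul, hstar, h2, hH.eq]
        simp only [mul_assoc]
      · calc NormedSpace.exp (t • ξ) * Q * NormedSpace.exp (t • -ξ) *
              (NormedSpace.exp (t • ξ) * Q * NormedSpace.exp (t • -ξ))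
            = NormedSpace.exp (t • ξ) * (Q * (NormedSpace.exp (t • -ξ) *
              NormedSpace.exp (t • ξ)) * Q) * NormedSpace.exp (t • -ξ) := by noncomm_ring
          _ = _ := by rw [hi, mul_one, hI]
      · rw [Matrix.trace_mul_comm, ← mul_assoc, hi, one_mul, hT]
    · have e1 : HasDerivAt (fun t : ℝ => NormedSpace.exp (t • ξ)) ξ 0 := by
        simpa using hasDerivAt_exp_smul_const (𝕂 := ℝ) ξ (0 : ℝ)
      have e2 : HasDerivAt (fun t : ℝ => NormedSpace.exp (t • -ξ)) (-ξ) 0 := by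
        simpa using hasDerivAt_exp_smul_const (𝕂 := ℝ) (-ξ) (0 : ℝ)
      have e3 := (e1.mul_const Q).mul e2
      have h : U * Q * Q = U * Q := by rw [mul_assoc, hI]
      have h' : ξ * Q * NormedSpace.exp ((0 : ℝ) • -ξ) +
          NormedSpace.exp ((0 : ℝ) • ξ) * Q * -ξ = U := by
        simp only [zero_smul, NormedSpace.exp_zero, mul_one, one_mul, hξ, sub_mul, mul_sub, mul_neg,
          ← mul_assoc, h, hI, hz]
        conv_rhs => rw [← hE]
        abel
      rw [h'] at e3
      exact e3

theorem diagonal_three (a b c : ℂ) :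
    Matrix.diagonal ![a, b, c] = !![a, 0, 0; 0, b, 0; 0, 0, c] := by
  ext i j
  fin_cases i <;> fin_cases j <;> simp

/-- Complementary `2 × 2` minors of a rotation of `ℝ⁴` agree. -/
theorem minors_eq (O : Matrix (Fin 4) (Fin 4) ℝ) (hO : O * Oᵀ = 1) (hd : O.det = 1) :
    O 0 0 * O 1 1 - O 0 1 * O 1 0 = O 2 2 * O 3 3 - O 2 3 * O 3 2 ∧
    O 0 2 * O 1 3 - O 0 3 * O 1 2 = O 2 0 * O 3 1 - O 2 1 * O 3 0 ∧
    O 0 0 * O 1 2 - O 0 2 * O 1 0 = -(O 2 1 * O 3 3 - O 2 3 * O 3 1) ∧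
    O 0 1 * O 1 3 - O 0 3 * O 1 1 = -(O 2 0 * O 3 2 - O 2 2 * O 3 0) ∧
    O 0 0 * O 1 3 - O 0 3 * O 1 0 = O 2 1 * O 3 2 - O 2 2 * O 3 1 ∧
    O 0 1 * O 1 2 - O 0 2 * O 1 1 = O 2 0 * O 3 3 - O 2 3 * O 3 0 := by
  have key : ∀ c d : Fin 4, (Matrix.of ![O 0, O 1, Pi.single c 1, Pi.single d 1]).det =
      (Matrix.of ![Pi.single 0 1, Pi.single 1 1, fun j => O j c, fun j => O j d]).det := by
    intro c d
    have h : Matrix.of ![O 0, O 1, Pi.single c 1, Pi.single d 1] * Oᵀ =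
        Matrix.of ![Pi.single 0 1, Pi.single 1 1, fun j => O j c, fun j => O j d] := by
      ext i j
      have h0 := congrFun (congrFun hO 0) j
      have h1 := congrFun (congrFun hO 1) j
      simp only [Matrix.mul_apply, Matrix.transpose_apply, Matrix.one_apply] at h0 h1
      fin_cases i
      · simpa [Matrix.mul_apply, Pi.single_apply, eq_comm] using h0
      · simpa [Matrix.mul_apply, Pi.single_apply, eq_comm] using h1
      · simp [Matrix.mul_apply, Pi.single_apply]
      · simp [Matrix.mul_apply, Pi.single_apply]
    rw [← h, Matrix.det_mul, Matrix.det_transpose, hd, mul_one]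
  have k1 := key 2 3
  have k2 := key 0 1
  have k3 := key 1 3
  have k4 := key 0 2
  have k5 := key 1 2
  have k6 := key 0 3
  simp [Matrix.det_succ_row_zero, Fin.sum_univ_succ, Fin.succAbove, Pi.single_apply] at k1 k2 k3 k4 k5 k6
  refine ⟨?_, ?_, ?_, ?_, ?_, ?_⟩ <;> linarith

/-- The tangent vector of `ℂℙ²` at `g e₀` with coordinates `u` in the frame `g e₁, g e₂`. -/
noncomputable def stdTangent (g : CMat) (u : Fin 4 → ℝ) : CMat :=
  g * !![0, ⟨u 0, -u 1⟩, ⟨u 2, -u 3⟩; ⟨u 0, u 1⟩, 0, 0; ⟨u 2, u 3⟩, 0, 0] * gᴴ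

/-- The element of `LambdaMinus` with coordinates `x` in the frame `g e₁, g e₂`. -/
noncomputable def stdLambda (g : CMat) (x : Fin 3 → ℝ) : CMat :=
  g * !![0, 0, 0; 0, ⟨x 0, 0⟩, ⟨x 1, -x 2⟩; 0, ⟨x 1, x 2⟩, ⟨-x 0, 0⟩] * gᴴ

theorem exists_unitary {Q : CMat} (hQ : Q ∈ CP2) :
    ∃ g : CMat, gᴴ * g = 1 ∧ g * gᴴ = 1 ∧ Q = g * Matrix.diagonal ![1, 0, 0] * gᴴ := by
  obtain ⟨hH, hI, hT⟩ := hQ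
  obtain ⟨V, hV⟩ : ∃ V : CMat, V = (hH.eigenvectorUnitary).1 := ⟨_, rfl⟩
  have hV1 : Vᴴ * V = 1 := hV ▸ Unitary.coe_star_mul_self hH.eigenvectorUnitary
  have hV2 : V * Vᴴ = 1 := hV ▸ Unitary.coe_mul_star_self hH.eigenvectorUnitary
  set lam : Fin 3 → ℂ := fun i => (hH.eigenvalues i : ℂ) with hlam
  have hs : Q = V * Matrix.diagonal lam * Vᴴ := by
    have h := hH.spectral_theorem
    rw [Unitary.conjStarAlgAut_apply] at h
    rw [hV]; exact h
  have hD : Matrix.diagonal lam = Vᴴ * Q * V := by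
    rw [hs]
    calc Matrix.diagonal lam = (Vᴴ * V) * Matrix.diagonal lam * (Vᴴ * V) := by simp [hV1]
      _ = _ := by noncomm_ring
  have hD2 : Matrix.diagonal lam * Matrix.diagonal lam = Matrix.diagonal lam := by
    rw [hD]
    calc Vᴴ * Q * V * (Vᴴ * Q * V) = Vᴴ * (Q * (V * Vᴴ) * Q) * V := by noncomm_ring
      _ = _ := by rw [hV2, mul_one, hI]
  have h01 : ∀ i, lam i = 0 ∨ lam i = 1 := by
    intro i
    have h := congrFun (congrFun hD2 i) i
    simp only [Matrix.diagonal_mul_diagonal, Matrix.diagonal_apply_eq] at h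
    have : lam i * (lam i - 1) = 0 := by linear_combination h
    rcases mul_eq_zero.mp this with h | h
    · exact Or.inl h
    · exact Or.inr (sub_eq_zero.mp h)
  have htr : lam 0 + lam 1 + lam 2 = 1 := by
    have h := congrArg Matrix.trace hD
    rw [Matrix.trace_mul_comm, ← mul_assoc, hV2, one_mul, hT, Matrix.trace_diagonal,
      Fin.sum_univ_three] at h
    exact h
  have fin : ∀ W : CMat, Wᴴ * W = 1 → W * Wᴴ = 1 →
      Matrix.diagonal lam = W * Matrix.diagonal ![1, 0, 0] * Wᴴ →
      ∃ g : CMat, gᴴ * g = 1 ∧ g * gᴴ = 1 ∧ Q = g * Matrix.diagonal ![1, 0, 0] * gᴴ := by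
    intro W h1 h2 h3
    refine ⟨V * W, ?_, ?_, ?_⟩
    · rw [Matrix.conjTranspose_mul]
      calc Wᴴ * Vᴴ * (V * W) = Wᴴ * (Vᴴ * V) * W := by noncomm_ring
        _ = 1 := by rw [hV1, mul_one, h1]
    · rw [Matrix.conjTranspose_mul]
      calc V * W * (Wᴴ * Vᴴ) = V * (W * Wᴴ) * Vᴴ := by noncomm_ring
        _ = 1 := by rw [h2, mul_one, hV2]
    · rw [Matrix.conjTranspose_mul, hs, h3]; noncomm_ring
  have hl : lam = ![lam 0, lam 1, lam 2] := by ext i; fin_cases i <;> rfl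
  rcases h01 0 with h0 | h0 <;> rcases h01 1 with h1 | h1 <;> rcases h01 2 with h2 | h2 <;>
    rw [h0, h1, h2] at htr hl <;> try (exfalso; norm_num at htr; done)
  · apply fin !![0, 0, 1; 0, 1, 0; 1, 0, 0] <;> (try rw [hl]) <;> ext i j <;>
      fin_cases i <;> fin_cases j <;>
      simp [diagonal_three, Matrix.mul_apply, Fin.sum_univ_three]
  · apply fin !![0, 1, 0; 1, 0, 0; 0, 0, 1] <;> (try rw [hl]) <;> ext i j <;>
      fin_cases i <;> fin_cases j <;>
      simp [diagonal_three, Matrix.mul_apply, Fin.sum_univ_three]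
  · apply fin 1 <;> simp [hl]

theorem trace_conj2 {g : CMat} (h1 : gᴴ * g = 1) (M N : CMat) :
    ((g * M * gᴴ) * (g * N * gᴴ)).trace = (M * N).trace := by
  have h : (g * M * gᴴ) * (g * N * gᴴ) = g * (M * (gᴴ * g) * N * gᴴ) := by noncomm_ring
  rw [h, Matrix.trace_mul_comm, h1]
  simp only [mul_one, mul_assoc, h1]

theorem trace_conj3 {g : CMat} (h1 : gᴴ * g = 1) (L M N : CMat) :
    ((g * L * gᴴ) * (g * M * gᴴ) * (g * N * gᴴ)).trace = (L * M * N).trace := by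
  have h : (g * L * gᴴ) * (g * M * gᴴ) = g * (L * M) * gᴴ := by
    calc (g * L * gᴴ) * (g * M * gᴴ) = g * (L * (gᴴ * g) * M) * gᴴ := by noncomm_ring
      _ = _ := by rw [h1, mul_one]
  rw [h, trace_conj2 h1]

theorem fsMetric_std {g : CMat} (h1 : gᴴ * g = 1) (u v : Fin 4 → ℝ) :
    fsMetric (stdTangent g u) (stdTangent g v) =
      4 * (u 0 * v 0 + u 1 * v 1 + u 2 * v 2 + u 3 * v 3) := by
  rw [fsMetric, stdTangent, stdTangent, trace_conj2 h1]
  simp [Matrix.trace, Fin.sum_univ_three]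
  ring

theorem fsKahler_std {g : CMat} (h1 : gᴴ * g = 1) (u v : Fin 4 → ℝ) :
    fsKahler (g * Matrix.diagonal ![1, 0, 0] * gᴴ) (stdTangent g u) (stdTangent g v) =
      4 * (u 0 * v 1 - u 1 * v 0 + u 2 * v 3 - u 3 * v 2) := by
  rw [fsKahler, stdTangent, stdTangent, trace_conj3 h1]
  simp [Matrix.trace, Fin.sum_univ_three, diagonal_three]
  ring

theorem asdForm_std {g : CMat} (h1 : gᴴ * g = 1) (x : Fin 3 → ℝ) (u v : Fin 4 → ℝ) :
    asdForm (stdLambda g x) (stdTangent g u) (stdTangent g v) =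
      4 * (x 0 * (-(u 0 * v 1 - u 1 * v 0) + (u 2 * v 3 - u 3 * v 2))
        + x 1 * (-(u 0 * v 3 - u 3 * v 0) + (u 1 * v 2 - u 2 * v 1))
        + x 2 * ((u 0 * v 2 - u 2 * v 0) - (u 3 * v 1 - u 1 * v 3))) := by
  rw [asdForm, stdTangent, stdTangent, stdLambda, trace_conj3 h1]
  simp [Matrix.trace, Fin.sum_univ_three]
  ring

theorem tangent_iff {g : CMat} (h1 : gᴴ * g = 1) (h2 : g * gᴴ = 1)
    (hQ : g * Matrix.diagonal ![1, 0, 0] * gᴴ ∈ CP2) {U : CMat} :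
    U ∈ tangentVectors CP2 (g * Matrix.diagonal ![1, 0, 0] * gᴴ) ↔ ∃ u, U = stdTangent g u := by
  rw [mem_tangentVectors_CP2 hQ]
  obtain ⟨W, rfl⟩ : ∃ W, U = g * W * gᴴ := ⟨gᴴ * U * g, by
    calc U = (g * gᴴ) * U * (g * gᴴ) := by rw [h2]; simp
      _ = _ := by noncomm_ring⟩
  have inj : ∀ M N : CMat, g * M * gᴴ = g * N * gᴴ → M = N := by
    intro M N h
    calc M = (gᴴ * g) * M * (gᴴ * g) := by rw [h1]; simp
      _ = gᴴ * (g * M * gᴴ) * g := by noncomm_ring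
      _ = gᴴ * (g * N * gᴴ) * g := by rw [h]
      _ = (gᴴ * g) * N * (gᴴ * g) := by noncomm_ring
      _ = N := by rw [h1]; simp
  have hmul : ∀ M N : CMat, (g * M * gᴴ) * (g * N * gᴴ) = g * (M * N) * gᴴ := by
    intro M N
    calc (g * M * gᴴ) * (g * N * gᴴ) = g * (M * (gᴴ * g) * N) * gᴴ := by noncomm_ring
      _ = _ := by rw [h1, mul_one]
  have hct : ∀ M : CMat, (g * M * gᴴ)ᴴ = g * Mᴴ * gᴴ := by
    intro M
    rw [Matrix.conjTranspose_mul, Matrix.conjTranspose_mul, Matrix.conjTranspose_conjTranspose,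
      mul_assoc]
  rw [Matrix.IsHermitian, hct, hmul, hmul, ← add_mul, ← mul_add]
  constructor
  · rintro ⟨hh, hE⟩
    have hh := inj _ _ hh
    have hE := inj _ _ hE
    refine ⟨![(W 1 0).re, (W 1 0).im, (W 2 0).re, (W 2 0).im], ?_⟩
    rw [stdTangent]
    congr 2
    have hij : ∀ i j, star (W j i) = W i j := fun i j => congrFun (congrFun hh i) j
    have hEij := fun i j => congrFun (congrFun hE i) j
    have a := hEij 0 0
    have b := hEij 1 1
    have c := hEij 1 2
    have d := hEij 2 1
    have f := hEij 2 2
    simp [Matrix.mul_apply, Matrix.diagonal] at a b c d f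
    have p := hij 0 1
    have q := hij 0 2
    ext i j
    fin_cases i <;> fin_cases j <;> simp [a, ← b, ← c, ← d, ← f, ← p, ← q, Complex.ext_iff]
  · rintro ⟨u, hu⟩
    rw [stdTangent] at hu
    rw [inj _ _ hu]
    constructor <;> congr 2 <;> ext i j <;> fin_cases i <;> fin_cases j <;>
      simp [diagonal_three, Complex.ext_iff]

theorem lambda_iff {g : CMat} (h1 : gᴴ * g = 1) (h2 : g * gᴴ = 1) {Y : CMat} :
    Y ∈ LambdaMinus (g * Matrix.diagonal ![1, 0, 0] * gᴴ) ↔ ∃ x, Y = stdLambda g x := by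
  obtain ⟨W, rfl⟩ : ∃ W, Y = g * W * gᴴ := ⟨gᴴ * Y * g, by
    calc Y = (g * gᴴ) * Y * (g * gᴴ) := by rw [h2]; simp
      _ = _ := by noncomm_ring⟩
  have inj : ∀ M N : CMat, g * M * gᴴ = g * N * gᴴ → M = N := by
    intro M N h
    calc M = (gᴴ * g) * M * (gᴴ * g) := by rw [h1]; simp
      _ = gᴴ * (g * M * gᴴ) * g := by noncomm_ring
      _ = gᴴ * (g * N * gᴴ) * g := by rw [h]
      _ = (gᴴ * g) * N * (gᴴ * g) := by noncomm_ring
      _ = N := by rw [h1]; simp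
  have hmul : ∀ M N : CMat, (g * M * gᴴ) * (g * N * gᴴ) = g * (M * N) * gᴴ := by
    intro M N
    calc (g * M * gᴴ) * (g * N * gᴴ) = g * (M * (gᴴ * g) * N) * gᴴ := by noncomm_ring
      _ = _ := by rw [h1, mul_one]
  have hct : ∀ M : CMat, (g * M * gᴴ)ᴴ = g * Mᴴ * gᴴ := by
    intro M
    rw [Matrix.conjTranspose_mul, Matrix.conjTranspose_mul, Matrix.conjTranspose_conjTranspose,
      mul_assoc]
  have htr : (g * W * gᴴ).trace = W.trace := by
    rw [Matrix.trace_mul_comm, ← mul_assoc, h1, one_mul]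
  have hz : g * (W * Matrix.diagonal ![1, 0, 0]) * gᴴ = 0 ↔ W * Matrix.diagonal ![1, 0, 0] = 0 :=
    ⟨fun h => inj _ _ (by rw [h]; simp), fun h => by rw [h]; simp⟩
  show (Matrix.IsHermitian _ ∧ _ ∧ _) ↔ _
  rw [Matrix.IsHermitian, hct, hmul, hz, htr]
  constructor
  · rintro ⟨hh, hE, ht⟩
    have hh := inj _ _ hh
    refine ⟨![(W 1 1).re, (W 1 2).re, -(W 1 2).im], ?_⟩
    rw [stdLambda]
    congr 2
    have hij : ∀ i j, star (W j i) = W i j := fun i j => congrFun (congrFun hh i) j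
    have hEij := fun i j => congrFun (congrFun hE i) j
    have a := hEij 0 0
    have b := hEij 1 0
    have c := hEij 2 0
    simp [Matrix.mul_apply, Matrix.diagonal] at a b c
    have p := hij 0 1
    have q := hij 0 2
    have r := hij 2 1
    have d := congrArg Complex.im (hij 1 1)
    rw [b] at p
    rw [c] at q
    simp [Matrix.trace, Fin.sum_univ_three, a] at ht
    have ht' : W 2 2 = - W 1 1 := by linear_combination ht
    simp at d
    have d' : (W 1 1).im = 0 := by linarith
    ext i j
    fin_cases i <;> fin_cases j <;>
      simp [a, b, c, ← p, ← q, ← r, ht', d', Complex.ext_iff]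
  · rintro ⟨u, hu⟩
    rw [stdLambda] at hu
    rw [inj _ _ hu]
    refine ⟨?_, ?_, ?_⟩
    · congr 2
      ext i j
      fin_cases i <;> fin_cases j <;> simp [Complex.ext_iff]
    · ext i j
      fin_cases i <;> fin_cases j <;> simp [Matrix.mul_apply, Fin.sum_univ_three, diagonal_three]
    · simp [Matrix.trace, Fin.sum_univ_three, Complex.ext_iff]

theorem stdTangent_add (g : CMat) (u v : Fin 4 → ℝ) :
    stdTangent g (u + v) = stdTangent g u + stdTangent g v := by
  rw [stdTangent, stdTangent, stdTangent, ← add_mul, ← mul_add]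
  congr 2
  ext i j
  fin_cases i <;> fin_cases j <;> simp [Complex.ext_iff, add_comm]

theorem stdTangent_smul (g : CMat) (c : ℝ) (u : Fin 4 → ℝ) :
    stdTangent g (c • u) = c • stdTangent g u := by
  rw [stdTangent, stdTangent, ← smul_mul_assoc, ← mul_smul_comm]
  congr 2
  ext i j
  fin_cases i <;> fin_cases j <;> simp [Complex.ext_iff]

/-- `Y ↦ asdForm Y` is a bijection of `LambdaMinus Q` with the anti-self-dual 2-forms at `Q`. -/
theorem isAntiSelfDual_iff {Q : CMat} (hQ : Q ∈ CP2) (B : CMat →ₗ[ℝ] CMat →ₗ[ℝ] ℝ) :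
    IsAntiSelfDual Q B ↔ ∃! Y, Y ∈ LambdaMinus Q ∧
      ∀ U ∈ tangentVectors CP2 Q, ∀ V ∈ tangentVectors CP2 Q, B U V = asdForm Y U V := by
  obtain ⟨g, h1, h2, rfl⟩ := exists_unitary hQ
  have hE : ∀ u, stdTangent g u ∈ tangentVectors CP2 (g * Matrix.diagonal ![1, 0, 0] * gᴴ) :=
    fun u => (tangent_iff h1 h2 hQ).2 ⟨u, rfl⟩
  constructor
  · rintro ⟨halt, hasd⟩
    have hadd := stdTangent_add g
    have hsm := stdTangent_smul g
    set E : Fin 4 → CMat := fun i => stdTangent g (Pi.single i (1 / 2)) with hEdef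
    have hdec : ∀ u, stdTangent g u =
        (2 * u 0) • E 0 + (2 * u 1) • E 1 + (2 * u 2) • E 2 + (2 * u 3) • E 3 := by
      intro u
      simp only [hEdef, ← hsm, ← hadd]
      congr 1
      ext i
      fin_cases i <;> simp <;> ring
    have hdiag : ∀ i, B (E i) (E i) = 0 := fun i => halt _ (hE _)
    have hanti : ∀ i j, B (E j) (E i) = -B (E i) (E j) := by
      intro i j
      have h := halt (E i + E j) (by simp only [hEdef, ← hadd]; exact hE _)
      simp only [map_add, LinearMap.add_apply, hdiag] at h
      linarith
    have hon : ∀ i j k l : Fin 4,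
        (∀ a b : Fin 4, fsMetric (![E i, E j, E k, E l] a) (![E i, E j, E k, E l] b) =
          if a = b then 1 else 0) →
        fsVolume (g * Matrix.diagonal ![1, 0, 0] * gᴴ) ![E i, E j, E k, E l] = 1 →
        B (E i) (E j) + B (E k) (E l) = 0 := by
      intro i j k l hm hv
      have h := hasd ![E i, E j, E k, E l]
        (by intro a; fin_cases a <;> simp [hEdef, hE]) hm hv
      simpa using h
    have r1 := hon 0 1 2 3
      (by intro a b; fin_cases a <;> fin_cases b <;> simp [hEdef, fsMetric_std h1] <;> norm_num)
      (by simp [fsVolume, hEdef, fsKahler_std h1]; norm_num)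
    have r2 := hon 0 2 3 1
      (by intro a b; fin_cases a <;> fin_cases b <;> simp [hEdef, fsMetric_std h1] <;> norm_num)
      (by simp [fsVolume, hEdef, fsKahler_std h1]; norm_num)
    have r3 := hon 0 3 1 2
      (by intro a b; fin_cases a <;> fin_cases b <;> simp [hEdef, fsMetric_std h1] <;> norm_num)
      (by simp [fsVolume, hEdef, fsKahler_std h1]; norm_num)
    refine ⟨stdLambda g ![-B (E 0) (E 1), -B (E 0) (E 3), B (E 0) (E 2)],
      ⟨(lambda_iff h1 h2).2 ⟨_, rfl⟩, ?_⟩, ?_⟩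
    · intro U hU V hV
      obtain ⟨u, rfl⟩ := (tangent_iff h1 h2 hQ).1 hU
      obtain ⟨v, rfl⟩ := (tangent_iff h1 h2 hQ).1 hV
      rw [asdForm_std h1, hdec u, hdec v]
      simp only [map_add, map_smul, LinearMap.add_apply, LinearMap.smul_apply, smul_eq_mul, hdiag,
        hanti 0 1, hanti 0 2, hanti 0 3, hanti 1 2, hanti 1 3, hanti 2 3,
        Matrix.cons_val_zero, Matrix.cons_val_one, Matrix.cons_val]
      have r2' : B (E 1) (E 3) = B (E 0) (E 2) := by rw [hanti 1 3] at r2; linarith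
      have r1' : B (E 2) (E 3) = -B (E 0) (E 1) := by linarith
      have r3' : B (E 1) (E 2) = -B (E 0) (E 3) := by linarith
      rw [r1', r2', r3']
      ring
    · rintro Y ⟨hY, hB⟩
      obtain ⟨x, rfl⟩ := (lambda_iff h1 h2).1 hY
      have b1 := hB (E 0) (hE _) (E 1) (hE _)
      have b2 := hB (E 0) (hE _) (E 2) (hE _)
      have b3 := hB (E 0) (hE _) (E 3) (hE _)
      rw [b1, b2, b3]
      simp only [hEdef, asdForm_std h1]
      congr 1
      ext i
      fin_cases i <;> simp <;> ring
  · rintro ⟨Y, ⟨hY, hB⟩, -⟩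
    obtain ⟨x, rfl⟩ := (lambda_iff h1 h2).1 hY
    constructor
    · intro U hU
      rw [hB U hU U hU]
      obtain ⟨u, rfl⟩ := (tangent_iff h1 h2 hQ).1 hU
      rw [asdForm_std h1]
      ring
    · intro e he hon hvol
      rw [hB _ (he 0) _ (he 1), hB _ (he 2) _ (he 3)]
      choose u hu using fun i => (tangent_iff h1 h2 hQ).1 (he i)
      simp only [hu, fsMetric_std h1] at hon
      simp only [fsVolume, hu, fsKahler_std h1] at hvol
      simp only [hu, asdForm_std h1]
      have hm := minors_eq (Matrix.of fun i j => 2 * u i j)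
        (by
          ext i j
          simp only [Matrix.mul_apply, Matrix.transpose_apply, Matrix.of_apply,
            Fin.sum_univ_four, Matrix.one_apply]
          rw [← hon i j]
          ring)
        (by
          rw [← hvol]
          simp [Matrix.det_succ_row_zero, Fin.sum_univ_succ, Fin.succAbove]
          ring)
      simp only [Matrix.of_apply] at hm
      obtain ⟨m1, m2, m3, m4, m5, m6⟩ := hm
      linear_combination x 0 * (-m1 + m2) + x 1 * (-m5 + m6) + x 2 * (m3 + m4)

/-! ### The Bryant–Salamon `G₂`-structure -/

/-- `s²`, where `s` is the Euclidean distance to the zero section along the fibres of `X`. The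
Euclidean structure of the fibres is `⟨Y, Y'⟩ = tr(Y Y') / 2`, for which the forms `e¹² - e³⁴`
(`eⁱ` an oriented orthonormal coframe of `fsMetric`) have length one. -/
noncomputable def radiusSq (x : CMat × CMat) : ℝ := (x.2 * x.2).trace.re / 2

/-- The vertical part `Dy` of a tangent vector `v` of `X` at `x`, i.e. the covariant derivative of
the fibre coordinate with respect to the Levi-Civita connection. -/
def vertical (x v : CMat × CMat) : CMat := (1 - x.1) * v.2 * (1 - x.1)

/-- The vector product on the oriented Euclidean fibres of `Λ²₋(ℂℙ²)`. -/
noncomputable def cross (Y Y' : CMat) : CMat := (-(Complex.I / 2)) • (Y * Y' - Y' * Y)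

/-- The 4-form `ψ = *φ` of the Bryant–Salamon `G₂`-structure on `X = Λ²₋(ℂℙ²)` with metric
`f² g_{ℝ³} + f⁻² g_N`, `f = (1 + s²)^{-1/4}`, `g_N` the metric `fsMetric`:
`ψ = f⁻⁴ vol_N + Dy₂ ∧ Dy₃ ∧ Ω₁ + Dy₃ ∧ Dy₁ ∧ Ω₂ + Dy₁ ∧ Dy₂ ∧ Ω₃`
(dual to `φ = f⁻¹ ∑ Dyᵢ ∧ Ωᵢ - f³ Dy₁ ∧ Dy₂ ∧ Dy₃`), where `y = ∑ yᵢ Zᵢ` for an oriented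
orthonormal frame `Zᵢ` of the fibres (`cross Z₁ Z₂ = Z₃`) and `Ωᵢ = asdForm Zᵢ`. Written without
the frame, the last three terms are the wedge product of the 2-form `cross Dy Dy` and
the tautological 2-form, paired on the fibres. -/
noncomputable def bsPsi (x : CMat × CMat) (v : Fin 4 → CMat × CMat) : ℝ :=
  (1 + radiusSq x) * fsVolume x.1 (fun i => (v i).1)
    + (1 / 4) * ∑ σ : Equiv.Perm (Fin 4), ((Equiv.Perm.sign σ : ℤ) : ℝ) *
        asdForm (cross (vertical x (v (σ 0))) (vertical x (v (σ 1)))) (v (σ 2)).1 (v (σ 3)).1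

/-! ### The principal `SO(3)`-bundle over `X` -/

/-- The ambient space of the frame bundle. -/
abbrev FrameSpace := CMat × CMat × (Fin 3 → CMat)

/-- The projection of the bundle, `(Q, Y, Z) ↦ (Q, Y)`; it is linear. -/
def proj (p : FrameSpace) : CMat × CMat := (p.1, p.2.1)

/-- The total space `P` of the principal `SO(3)`-bundle over `X`: the pull-back to `X` of the
bundle of oriented orthonormal frames of `Λ²₋(ℂℙ²)`. -/
def P : Set FrameSpace :=
  {p | proj p ∈ X ∧ (∀ i, p.2.2 i ∈ LambdaMinus p.1) ∧
    (∀ i j, (p.2.2 i * p.2.2 j).trace = if i = j then 2 else 0) ∧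
    cross (p.2.2 0) (p.2.2 1) = p.2.2 2}

/-- The right action of `k ∈ SO(3)` on `P`; it is linear in `p`, so the same formula gives its
differential. -/
noncomputable def act (p : FrameSpace) (k : RMat) : FrameSpace :=
  (p.1, p.2.1, fun j => ∑ i, k i j • p.2.2 i)

/-- The value at `p` of the fundamental vertical vector field of `ξ ∈ 𝔰𝔬(3)`. -/
noncomputable def fundamental (p : FrameSpace) (ξ : RMat) : FrameSpace :=
  (0, 0, fun j => ∑ i, ξ i j • p.2.2 i)

/-- Matrix valued 1-forms on the ambient space of `P`. -/
abbrev OneForm := FrameSpace → FrameSpace [⋀^Fin 1]→L[ℝ] RMat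

/-- `A` is (restricts to) a smooth connection 1-form on the principal `SO(3)`-bundle `P → X`. -/
structure IsConnection (A : OneForm) : Prop where
  smooth : ∀ p ∈ P, ContDiffAt ℝ ∞ A p
  skew : ∀ p ∈ P, ∀ v ∈ tangentVectors P p, (A p ![v])ᵀ = -(A p ![v])
  vertical : ∀ p ∈ P, ∀ ξ : RMat, ξᵀ = -ξ → A p ![fundamental p ξ] = ξ
  equivariant : ∀ p ∈ P, ∀ k ∈ Matrix.specialOrthogonalGroup (Fin 3) ℝ,
    ∀ v ∈ tangentVectors P p, A (act p k) ![act v k] = kᵀ * A p ![v] * k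

/-- The curvature `F_A = dA + ½ [A ∧ A]` as a 2-form on `P`. -/
noncomputable def curvature (A : OneForm) (p v w : FrameSpace) : RMat :=
  extDeriv A p ![v, w] + (A p ![v] * A p ![w] - A p ![w] * A p ![v])

/-- The 6-form `F_A ∧ π^*ψ` on `P`, with `π : P → X` the projection. -/
noncomputable def curvatureWedgePsi (A : OneForm) (p : FrameSpace) (v : Fin 6 → FrameSpace) :
    RMat :=
  (1 / 48 : ℝ) • ∑ σ : Equiv.Perm (Fin 6), (((Equiv.Perm.sign σ : ℤ) : ℝ) *
    bsPsi (proj p) ![proj (v (σ 2)), proj (v (σ 3)), proj (v (σ 4)), proj (v (σ 5))]) •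
      curvature A p (v (σ 0)) (v (σ 1))

/-- The `G₂`-instanton equation `F_A ∧ ψ = 0` on all of `X` (checked after pull-back to `P`). -/
def IsG2Instanton (A : OneForm) : Prop :=
  ∀ p ∈ P, ∀ v : Fin 6 → FrameSpace, (∀ i, v i ∈ tangentVectors P p) →
    curvatureWedgePsi A p v = 0

/-- `p` and `q` are joined by a smooth `A`-horizontal path in `P`. -/
def HorizontalPath (A : OneForm) (p q : FrameSpace) : Prop :=
  ∃ γ : ℝ → FrameSpace, ContDiff ℝ ∞ γ ∧ (∀ t, γ t ∈ P) ∧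
    (∀ t ∈ Set.Icc (0 : ℝ) 1, A (γ t) ![deriv γ t] = 0) ∧ γ 0 = p ∧ γ 1 = q

/-- The holonomy group of `A` at `p`: all `k ∈ SO(3)` such that `p` and `p · k` are joined by a
piecewise smooth horizontal path. -/
def holonomy (A : OneForm) (p : FrameSpace) : Set RMat :=
  {k | k ∈ Matrix.specialOrthogonalGroup (Fin 3) ℝ ∧
    Relation.ReflTransGen (HorizontalPath A) p (act p k)}

/-- `A` is irreducible: it does not reduce to a proper subgroup, i.e. its holonomy group is
all of `SO(3)`. -/
def IsIrreducibleConnection (A : OneForm) : Prop :=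
  ∀ p ∈ P, holonomy A p = {k | k ∈ Matrix.specialOrthogonalGroup (Fin 3) ℝ}

/-! ### The bundle `P_{α₂}` over the complement of the zero section -/

/-- The group `SU(3)` as a subset of the matrices. -/
def SU3 : Set CMat := {g | g ∈ Matrix.specialUnitaryGroup (Fin 3) ℂ}

/-- The diagonal maximal torus `U(1)²` of `SU(3)`. -/
def torus : Set CMat := {t | t ∈ SU3 ∧ t.IsDiag}

/-- The identification `ℝ⁺ × SU(3) / U(1)² ≅ X \ {zero section}`, lifted to `ℝ⁺ × SU(3)`: the base
point is the line `g e₀`, and the fibre coordinate is at distance `s` from the zero section. -/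
noncomputable def twistorPoint (s : ℝ) (g : CMat) : CMat × CMat :=
  (g * Matrix.diagonal ![1, 0, 0] * gᴴ, s • (g * Matrix.diagonal ![0, 1, -1] * gᴴ))

/-- The standard basis of `𝔰𝔬(3)` with `[Tᵢ, Tⱼ] = -2 Tₖ` for cyclic `(i, j, k)`; it corresponds to
`√-1` times the Pauli matrices under `𝔰𝔲(2) ≅ 𝔰𝔬(3)`. -/
def T1 : RMat := !![0, 0, 0; 0, 0, 2; 0, -2, 0]

/-- See `T1`. -/
def T2 : RMat := !![0, 0, -2; 0, 0, 0; 2, 0, 0]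

/-- See `T1`. -/
def T3 : RMat := !![0, 2, 0; -2, 0, 0; 0, 0, 0]

/-- The homomorphism `e^{α₂} : U(1)² → U(1) ⊂ SO(3)`, where `α₂` is the root `θ₁ - θ₂` of the
fibres of the twistor projection `SU(3)/U(1)² → ℂℙ²` and `U(1) ⊂ SO(3)` is generated by `T1`. -/
def expAlpha (t : CMat) : RMat :=
  !![1, 0, 0;
     0, (t 1 1 * star (t 2 2)).re, (t 1 1 * star (t 2 2)).im;
     0, -(t 1 1 * star (t 2 2)).im, (t 1 1 * star (t 2 2)).re]

/-- `Φ` identifies the bundle `P_{α₂} = SU(3) ×_{(e^{α₂}, U(1)²)} SO(3)`, pulled back to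
`ℝ⁺ × SU(3)/U(1)² ≅ X \ {zero section}`, with the restriction of `P`, by `[s, g, k] ↦ Φ(s, g) · k`.
In other words `P` extends `P_{α₂}` across the zero section. -/
structure IsExtension (Φ : ℝ × CMat → FrameSpace) : Prop where
  smooth : ∀ s > 0, ∀ g ∈ SU3, ContDiffAt ℝ ∞ Φ (s, g)
  mem : ∀ s > 0, ∀ g ∈ SU3, Φ (s, g) ∈ P
  covers : ∀ s > 0, ∀ g ∈ SU3, proj (Φ (s, g)) = twistorPoint s g
  equivariant : ∀ s > 0, ∀ g ∈ SU3, ∀ t ∈ torus, Φ (s, g * t) = act (Φ (s, g)) (expAlpha t)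

/-! ### Left-invariant forms on `SU(3)`

Each form is evaluated at `g` on tangent vectors `a`, `b` of `SU(3)` at `g`. -/

/-- The Maurer–Cartan form `g⁻¹ dg`. -/
def mc (g a : CMat) : CMat := gᴴ * a

/-- The left-invariant extension of the weight `α₂`, in the normalization in which the canonical
invariant connection is `α ⊗ T1`. -/
noncomputable def alpha (g a : CMat) : ℝ := ((mc g a 1 1).im - (mc g a 2 2).im) / 2

/-- The left-invariant forms dual to the root space of `α₂`. -/
def nu1 (g a : CMat) : ℝ := (mc g a 1 2).im

/-- See `nu1`. -/
def nu2 (g a : CMat) : ℝ := (mc g a 1 2).re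

/-- The left-invariant forms pulled back from `ℂℙ²`: an oriented orthonormal coframe for the
Fubini–Study metric of scalar curvature `24`. -/
def coframe (g a : CMat) : Fin 4 → ℝ :=
  ![(mc g a 1 0).re, (mc g a 1 0).im, (mc g a 2 0).re, (mc g a 2 0).im]

/-- The 2-form `eⁱ ∧ eʲ`, with `i`, `j` numbered from `0`. -/
def ee (i j : Fin 4) (g a b : CMat) : ℝ := coframe g a i * coframe g b j - coframe g b i * coframe g a j

/-- The basis of the anti-self-dual 2-forms for which `Ω₁ ⊗ T₁ + Ω₂ ⊗ T₂ + Ω₃ ⊗ T₃` is the curvature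
of the Levi-Civita connection `α ⊗ T₁ + ν₁ ⊗ T₂ + ν₂ ⊗ T₃` of `Λ²₋(ℂℙ²)`. -/
def Omega1 (g a b : CMat) : ℝ := -(ee 0 1 g a b - ee 2 3 g a b)

/-- See `Omega1`. -/
def Omega2 (g a b : CMat) : ℝ := -(ee 0 3 g a b - ee 1 2 g a b)

/-- See `Omega1`. -/
def Omega3 (g a b : CMat) : ℝ := ee 0 2 g a b - ee 3 1 g a b

/-- The 1-form `α ⊗ T₁ + ε (1 + s²)^{-1/2} (ν₁ ⊗ T₂ + ν₂ ⊗ T₃)` on `ℝ⁺ × SU(3)`, at `(s, g)`, on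
the tangent vector `v`. -/
noncomputable def instantonForm (ε s : ℝ) (g : CMat) (v : ℝ × CMat) : RMat :=
  alpha g v.2 • T1 + (ε / √(1 + s ^ 2)) • (nu1 g v.2 • T2 + nu2 g v.2 • T3)

/-- The curvature formula, a 2-form on `ℝ⁺ × SU(3)`, at `(s, g)`, on the tangent vectors
`v`, `w`. -/
noncomputable def instantonCurvature (ε s : ℝ) (g : CMat) (v w : ℝ × CMat) : RMat :=
  (2 * s ^ 2 / (s ^ 2 + 1) * (nu1 g v.2 * nu2 g w.2 - nu1 g w.2 * nu2 g v.2)) • T1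
    + Omega1 g v.2 w.2 • T1
    + (ε / √(s ^ 2 + 1)) • (Omega2 g v.2 w.2 • T2 + Omega3 g v.2 w.2 • T3)
    - (ε * (s / (1 + s ^ 2) ^ (3 / 2 : ℝ))) •
      ((v.1 * nu1 g w.2 - w.1 * nu1 g v.2) • T2 + (v.1 * nu2 g w.2 - w.1 * nu2 g v.2) • T3)

end BSInstanton

open BSInstanton

namespace BSInstanton

/-! ### The connection -/

/-! A single connection `conn` on `P` serves both signs. The form in the theorem is the Levi-Civita
connection of the bundle of anti-self-dual forms with its ν-components shrunk by (1 + s²)^{-1/2}.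
Where the fibre coordinate is y = (s, 0, 0), the invariant 𝔰𝔬(3)-valued form y ∧ Dy is s² times
these components, up to sign, so the correction is h(s²) y ∧ Dy with h(u) = (1 - (1 + u)^{-1/2}) /
u. Rationalized, h(u) = 1 / (1 + u + √(1 + u)) (`profile`) has no singularity at u = 0, and the
connection extends over the zero section. The two signs are related by the gauge transformation
diag(1, 1, -1), which reverses ν₁, ν₂, Ω₂, Ω₃; hence ε enters only through `extensionMap`.

Every point of `P` is a `framePoint g y` with g unitary (`exists_framePoint`), and every tangent
vector there is given by a horizontal part u, a skew matrix a and D = Dy (`exists_frameTangent`).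
Pointwise identities thus become identities in these coordinates. The curvature is the vector c θ +
h ⟨y, θ⟩ y with c = 1 - s² h and θₘ = 2 Ωₘ + (Dy × Dy)ₘ / (1 + s²) (`curvature_conn`); the choice of
h enters through 2h - u h² = 1 / (1 + u) and a compatible formula for h'.

For the instanton equation it therefore suffices that θₘ ∧ ψ = 0 for each m
(`sum_instantonTwoForm_psiDensity`). Mixed products Ωₘ ∧ Ωₙ vanish, and the negative square of Ωₘ
cancels the volume term of ψ, whose factor 1 + s² is compensated by the denominator in θₘ.

For irreducibility, rays in the fibres are horizontal because y ∧ Dy = 0 on them, and on the zero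
section only the Levi-Civita connection remains. There, geodesic lunes and triangles in the
projective plane realize the phases and planar rotations (`reachable_phase`, `reachable_planar`),
which give all of SO(3) by Euler angles. -/

/-- The real part of the trace, as a continuous linear functional. -/
noncomputable def reTrace : CMat →L[ℝ] ℝ :=
  LinearMap.toContinuousLinearMap (Complex.reLm ∘ₗ (Matrix.traceLinearMap (Fin 3) ℝ ℂ))

theorem reTrace_apply (M : CMat) : reTrace M = M.trace.re := rfl

/-- The Euclidean structure `⟨M, N⟩ = Re tr(M N) / 2`. -/
noncomputable def pairing : CMat →L[ℝ] CMat →L[ℝ] ℝ :=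
  (ContinuousLinearMap.compL ℝ CMat CMat ℝ ((1 / 2 : ℝ) • reTrace)).comp
    (ContinuousLinearMap.mul ℝ CMat)

theorem pairing_apply (M N : CMat) : pairing M N = (M * N).trace.re / 2 := by
  simp [pairing, reTrace_apply]
  ring

theorem pairing_comm (M N : CMat) : pairing M N = pairing N M := by
  rw [pairing_apply, pairing_apply, Matrix.trace_mul_comm]

theorem radiusSq_eq (x : CMat × CMat) : radiusSq x = pairing x.2 x.2 := by
  rw [pairing_apply, radiusSq]

/-- The radial profile `(1 - (1 + u)^{-1/2}) / u` of the connection, where `u = s²`. -/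
noncomputable def profile (u : ℝ) : ℝ := (1 + u + √(1 + u))⁻¹

/-- The fibre coordinate `Y`, as a linear map on the ambient space. -/
noncomputable def fibreCLM : FrameSpace →L[ℝ] CMat :=
  (ContinuousLinearMap.fst ℝ CMat (Fin 3 → CMat)).comp
    (ContinuousLinearMap.snd ℝ CMat (CMat × (Fin 3 → CMat)))

/-- The frame vector `Zⱼ`, as a linear map on the ambient space. -/
noncomputable def frameCLM (j : Fin 3) : FrameSpace →L[ℝ] CMat :=
  (ContinuousLinearMap.proj j).comp ((ContinuousLinearMap.snd ℝ CMat (Fin 3 → CMat)).comp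
    (ContinuousLinearMap.snd ℝ CMat (CMat × (Fin 3 → CMat))))

@[simp] theorem fibreCLM_apply (v : FrameSpace) : fibreCLM v = v.2.1 := rfl

@[simp] theorem frameCLM_apply (j : Fin 3) (v : FrameSpace) : frameCLM j v = v.2.2 j := rfl

/-- The matrix entries of the connection. -/
noncomputable def connEntry (i j : Fin 3) (p : FrameSpace) : FrameSpace →L[ℝ] ℝ :=
  (1 / 2 : ℝ) • ((pairing (p.2.2 i)).comp (frameCLM j) - (pairing (p.2.2 j)).comp (frameCLM i)) +
    profile (pairing p.2.1 p.2.1) •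
      (pairing (p.2.2 i) p.2.1 • (pairing (p.2.2 j)).comp fibreCLM -
        pairing (p.2.2 j) p.2.1 • (pairing (p.2.2 i)).comp fibreCLM)

theorem connEntry_apply (i j : Fin 3) (p v : FrameSpace) :
    connEntry i j p v =
      (pairing (p.2.2 i) (v.2.2 j) - pairing (p.2.2 j) (v.2.2 i)) / 2 +
      profile (pairing p.2.1 p.2.1) * (pairing (p.2.2 i) p.2.1 * pairing (p.2.2 j) v.2.1 -
        pairing (p.2.2 j) p.2.1 * pairing (p.2.2 i) v.2.1) := by
  simp [connEntry]
  ring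

/-- The connection on `P`: the Levi-Civita connection of `Λ²₋(ℂℙ²)` plus
`profile (s²) (y ∧ Dy)`. -/
noncomputable def conn : OneForm := fun p =>
  ContinuousAlternatingMap.ofSubsingletonLIE (0 : Fin 1)
    (∑ i, ∑ j, (connEntry i j p).smulRight (Matrix.single i j (1 : ℝ)))

theorem conn_apply (p v : FrameSpace) (i j : Fin 3) : conn p ![v] i j = connEntry i j p v := by
  have h : conn p ![v] =
      (∑ i, ∑ j, (connEntry i j p).smulRight (Matrix.single i j (1 : ℝ)) : FrameSpace →L[ℝ] RMat)
        v := rfl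
  rw [h]
  simp [Matrix.sum_apply, Matrix.single_apply]
  fin_cases i <;> fin_cases j <;> simp [Fin.sum_univ_three]

theorem contDiffAt_profile {u : ℝ} (hu : 0 ≤ u) : ContDiffAt ℝ ∞ profile u := by
  have h : (0 : ℝ) < 1 + u := by linarith
  unfold profile
  refine ContDiffAt.inv (by fun_prop (disch := exact h.ne')) ?_
  positivity

/-- With r = √(1 + u) the profile is 1 / (r² + r). Writing the derivative through the profile and 1
/ (1 + u) alone keeps square roots out of the curvature computation. -/
theorem hasDerivAt_profile {u : ℝ} (hu : 0 ≤ u) :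
    HasDerivAt profile (-(profile u / (2 * (1 + u))) - profile u ^ 2 / 2) u := by
  have h : (0 : ℝ) < 1 + u := by linarith
  have h1 : HasDerivAt (fun u : ℝ => 1 + u) 1 u := by
    simpa using (hasDerivAt_id u).const_add 1
  have h2 := h1.add (h1.sqrt h.ne')
  have h3 : (0 : ℝ) < √(1 + u) := Real.sqrt_pos.2 h
  have h4 := h2.inv (by simp only [Pi.add_apply]; positivity)
  refine h4.congr_deriv ?_
  simp only [profile, Pi.add_apply]
  set r := √(1 + u) with hr
  have h5 : 1 + u = r ^ 2 := (Real.sq_sqrt h.le).symm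
  rw [h5]
  field_simp
  ring

-- The pairing is indefinite on general complex matrices; for Hermitian M the product is Mᴴ M. This
-- keeps 1 + |Y|² positive at points of `P`, where smoothness is needed.
open scoped ComplexOrder in
theorem pairing_self_nonneg {M : CMat} (hM : M.IsHermitian) : 0 ≤ pairing M M := by
  have h := Matrix.posSemidef_conjTranspose_mul_self M
  have h2 := (Complex.nonneg_iff.1 h.trace_nonneg).1
  rw [hM.eq] at h2
  rw [pairing_apply]
  linarith

theorem contDiffAt_conn {p : FrameSpace} (hp : 0 ≤ pairing p.2.1 p.2.1) :
    ContDiffAt ℝ ∞ conn p := by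
  unfold conn
  refine (ContinuousAlternatingMap.ofSubsingletonLIE (𝕜 := ℝ) (E := FrameSpace) (F := RMat)
    (0 : Fin 1)).contDiff.contDiffAt.comp p ?_
  refine ContDiffAt.sum fun i _ => ContDiffAt.sum fun j _ => ?_
  refine ContDiffAt.smulRight ?_ contDiffAt_const
  unfold connEntry
  have hY : ContDiff ℝ ∞ (fun p : FrameSpace => p.2.1) := fibreCLM.contDiff
  have hB : ContDiff ℝ ∞ (fun M : CMat => pairing M) :=
    ContinuousLinearMap.contDiff (𝕜 := ℝ) (E := CMat) (F := CMat →L[ℝ] ℝ) pairing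
  have hZ : ∀ k, ContDiff ℝ ∞ (fun p : FrameSpace => pairing (p.2.2 k)) := fun k =>
    hB.comp (frameCLM k).contDiff
  have hprof : ContDiffAt ℝ ∞ (fun p : FrameSpace => profile (pairing p.2.1 p.2.1)) p :=
    ContDiffAt.comp (g := profile) (f := fun p : FrameSpace => pairing p.2.1 p.2.1) p
      (contDiffAt_profile hp) ((hB.comp hY).clm_apply hY).contDiffAt
  have hc : ∀ k (L : FrameSpace →L[ℝ] CMat),
      ContDiff ℝ ∞ (fun p : FrameSpace => (pairing (p.2.2 k)).comp L) := fun k L =>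
    (hZ k).clm_comp contDiff_const
  have hy : ∀ k, ContDiff ℝ ∞ (fun p : FrameSpace => pairing (p.2.2 k) p.2.1) := fun k =>
    (hZ k).clm_apply hY
  refine ContDiffAt.add ?_ (hprof.smul ?_)
  · exact (((hc i _).sub (hc j _)).const_smul _).contDiffAt
  · exact (((hy i).smul (hc j _)).sub ((hy j).smul (hc i _))).contDiffAt

/-! ### The exterior derivative of the connection -/

/-- Constant ambient vector fields commute, so there is no bracket term. -/
theorem extDeriv_one_apply {A : OneForm} {p : FrameSpace} (h : DifferentiableAt ℝ A p)
    (v w : FrameSpace) :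
    extDeriv A p ![v, w] =
      fderiv ℝ (fun q => A q ![w]) p v - fderiv ℝ (fun q => A q ![v]) p w := by
  rw [extDeriv_apply h, Fin.sum_univ_two]
  have h0 : (0 : Fin 2).removeNth ![v, w] = ![w] := by
    funext i; fin_cases i; rfl
  have h1 : (1 : Fin 2).removeNth ![v, w] = ![v] := by
    funext i; fin_cases i; rfl
  simp [h0, h1, sub_eq_add_neg]

/-- The directional derivative of `connEntry` in the base point. -/
theorem fderiv_conn {p : FrameSpace} (hp : 0 ≤ pairing p.2.1 p.2.1) (v w : FrameSpace)
    (i j : Fin 3) :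
    (fderiv ℝ (fun q => conn q ![w]) p v) i j =
      (pairing (v.2.2 i) (w.2.2 j) - pairing (v.2.2 j) (w.2.2 i)) / 2 +
      (-(profile (pairing p.2.1 p.2.1) / (2 * (1 + pairing p.2.1 p.2.1)))
          - profile (pairing p.2.1 p.2.1) ^ 2 / 2) * (2 * pairing p.2.1 v.2.1) *
        (pairing (p.2.2 i) p.2.1 * pairing (p.2.2 j) w.2.1 -
          pairing (p.2.2 j) p.2.1 * pairing (p.2.2 i) w.2.1) +
      profile (pairing p.2.1 p.2.1) *
        ((pairing (v.2.2 i) p.2.1 + pairing (p.2.2 i) v.2.1) * pairing (p.2.2 j) w.2.1 +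
          pairing (p.2.2 i) p.2.1 * pairing (v.2.2 j) w.2.1 -
          (pairing (v.2.2 j) p.2.1 + pairing (p.2.2 j) v.2.1) * pairing (p.2.2 i) w.2.1 -
          pairing (p.2.2 j) p.2.1 * pairing (v.2.2 i) w.2.1) := by
  have hd : DifferentiableAt ℝ (fun q => conn q ![w]) p :=
    ((contDiffAt_conn hp).differentiableAt (by simp)).continuousAlternatingMap_apply_const _
  have hl := hd.hasFDerivAt.hasLineDerivAt v
  have hij : HasDerivAt (fun t : ℝ => conn (p + t • v) ![w] i j)
      (fderiv ℝ (fun q => conn q ![w]) p v i j) 0 :=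
    (LinearMap.toContinuousLinearMap (Matrix.entryLinearMap ℝ ℝ i j)).hasFDerivAt.comp_hasDerivAt
      0 hl
  refine hij.unique ?_
  simp only [conn_apply, connEntry_apply]
  have hline : HasDerivAt (fun t : ℝ => p + t • v) v 0 := by
    simpa using ((hasDerivAt_id (0 : ℝ)).smul_const v).const_add p
  have hY : HasDerivAt (fun t : ℝ => (p + t • v).2.1) v.2.1 0 :=
    fibreCLM.hasFDerivAt.comp_hasDerivAt 0 hline
  have hZ : ∀ k, HasDerivAt (fun t : ℝ => (p + t • v).2.2 k) (v.2.2 k) 0 := fun k =>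
    (frameCLM k).hasFDerivAt.comp_hasDerivAt 0 hline
  have hp2 : ∀ k (N : CMat), HasDerivAt (fun t : ℝ => pairing ((p + t • v).2.2 k) N)
      (pairing (v.2.2 k) N) 0 := fun k N =>
    (pairing.flip N).hasFDerivAt.comp_hasDerivAt 0 (hZ k)
  have hb : ∀ {f g : ℝ → CMat} {f' g' : CMat}, HasDerivAt f f' 0 → HasDerivAt g g' 0 →
      HasDerivAt (fun t => pairing (f t) (g t)) (pairing f' (g 0) + pairing (f 0) g') 0 := by
    intro f g f' g' hf hg
    have h := pairing.hasFDerivAt_of_bilinear hf.hasFDerivAt hg.hasFDerivAt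
    have h := h.hasDerivAt
    refine h.congr_deriv ?_
    simp [add_comm]
  have hu := hb hY hY
  have hprof := HasDerivAt.comp (h₂ := profile) (0 : ℝ)
    (by simpa using hasDerivAt_profile hp) hu
  have h := (((hp2 i (w.2.2 j)).sub (hp2 j (w.2.2 i))).div_const 2).add
    (hprof.mul (((hb (hZ i) hY).mul (hp2 j w.2.1)).sub ((hb (hZ j) hY).mul (hp2 i w.2.1))))
  refine h.congr_deriv ?_
  simp only [zero_smul, add_zero, Function.comp_apply, Pi.mul_apply, Pi.sub_apply,
    pairing_comm v.2.1 p.2.1]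
  ring

/-! ### The connection axioms -/

/-- The antisymmetrization built into `connEntry` gives this on the whole ambient space; along `P`
it changes nothing, as orthonormality already makes ⟨Zᵢ, dZⱼ⟩ skew. -/
theorem conn_skew (p v : FrameSpace) : (conn p ![v])ᵀ = -(conn p ![v]) := by
  ext i j
  simp only [Matrix.transpose_apply, Matrix.neg_apply, conn_apply, connEntry_apply]
  ring

theorem pairing_frame {p : FrameSpace} (hp : p ∈ P) (i j : Fin 3) :
    pairing (p.2.2 i) (p.2.2 j) = if i = j then 1 else 0 := by
  rw [pairing_apply, hp.2.2.1 i j]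
  split_ifs <;> simp

theorem pairing_fibre_nonneg {p : FrameSpace} (hp : p ∈ P) : 0 ≤ pairing p.2.1 p.2.1 :=
  pairing_self_nonneg hp.1.2.1

theorem isConnection_conn : IsConnection conn where
  smooth p hp := contDiffAt_conn (pairing_fibre_nonneg hp)
  skew p _ v _ := conn_skew p v
  vertical p hp ξ hξ := by
    ext i j
    have h : ∀ i j, ξ j i = -ξ i j := fun i j => congrFun (congrFun hξ i) j
    simp [conn_apply, connEntry_apply, fundamental, pairing_frame hp, h i j]
  equivariant p _ k _ v _ := by
    ext i j
    have h : profile (pairing (act p k).2.1 (act p k).2.1) = profile (pairing p.2.1 p.2.1) := rfl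
    simp only [Matrix.mul_apply, Matrix.transpose_apply, conn_apply, connEntry_apply, h]
    simp only [act, Fin.sum_univ_three, map_add, map_smul, add_apply, smul_apply, smul_eq_mul]
    ring

/-! ### Adapted unitary frames -/

/-- The traceless Hermitian endomorphism of `e₀^⊥` with coordinates `x` in the Pauli matrices. -/
noncomputable def pauli (x : Fin 3 → ℝ) : CMat :=
  !![0, 0, 0; 0, ⟨x 0, 0⟩, ⟨x 1, -x 2⟩; 0, ⟨x 1, x 2⟩, ⟨-x 0, 0⟩]

/-- The tangent vector of `ℂℙ²` at the line of `e₀` with coordinates `u`. -/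
noncomputable def baseTangent (u : Fin 4 → ℝ) : CMat :=
  !![0, ⟨u 0, -u 1⟩, ⟨u 2, -u 3⟩; ⟨u 0, u 1⟩, 0, 0; ⟨u 2, u 3⟩, 0, 0]

theorem stdLambda_eq (g : CMat) (x : Fin 3 → ℝ) : stdLambda g x = g * pauli x * gᴴ := rfl

theorem stdTangent_eq (g : CMat) (u : Fin 4 → ℝ) : stdTangent g u = g * baseTangent u * gᴴ := rfl

/-- The anticommutator. -/
def anticomm (M U : CMat) : CMat := M * U + U * M

theorem conj_mul_conj {g : CMat} (h1 : gᴴ * g = 1) (M N : CMat) :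
    (g * M * gᴴ) * (g * N * gᴴ) = g * (M * N) * gᴴ := by
  calc (g * M * gᴴ) * (g * N * gᴴ) = g * (M * (gᴴ * g) * N) * gᴴ := by noncomm_ring
    _ = _ := by rw [h1, mul_one]

theorem anticomm_std {g : CMat} (h1 : gᴴ * g = 1) (x : Fin 3 → ℝ) (u : Fin 4 → ℝ) :
    anticomm (stdLambda g x) (stdTangent g u) =
      g * anticomm (pauli x) (baseTangent u) * gᴴ := by
  rw [anticomm, stdLambda_eq, stdTangent_eq, conj_mul_conj h1, conj_mul_conj h1, anticomm, mul_add,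
    add_mul]

theorem pairing_conj {g : CMat} (h1 : gᴴ * g = 1) (M N : CMat) :
    pairing (g * M * gᴴ) (g * N * gᴴ) = pairing M N := by
  rw [pairing_apply, pairing_apply, trace_conj2 h1]

theorem pairing_lambda {g : CMat} (h1 : gᴴ * g = 1) (x x' : Fin 3 → ℝ) :
    pairing (stdLambda g x) (stdLambda g x') = x 0 * x' 0 + x 1 * x' 1 + x 2 * x' 2 := by
  rw [stdLambda_eq, stdLambda_eq, pairing_conj h1, pairing_apply]
  simp [pauli, Matrix.trace, Fin.sum_univ_three]
  ring

theorem pairing_frame_lambda {g : CMat} (h1 : gᴴ * g = 1) (k : Fin 3) (x : Fin 3 → ℝ) :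
    pairing (stdLambda g (Pi.single k 1)) (stdLambda g x) = x k := by
  rw [pairing_lambda h1]
  fin_cases k <;> simp

/-- The endomorphism preserves the complement of the line, while the tangent vector exchanges line
and complement. The anticommutator is thus off-diagonal and orthogonal to the fibre, so pairing a
derivative with a frame vector extracts the covariant derivative. -/
theorem pairing_lambda_anticomm {g : CMat} (h1 : gᴴ * g = 1) (x x' : Fin 3 → ℝ) (u : Fin 4 → ℝ) :
    pairing (stdLambda g x) (anticomm (stdLambda g x') (stdTangent g u)) = 0 := by
  rw [anticomm_std h1, stdLambda_eq, pairing_conj h1, pairing_apply]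
  simp [pauli, baseTangent, anticomm, Matrix.trace, Fin.sum_univ_three]

theorem pairing_anticomm_lambda {g : CMat} (h1 : gᴴ * g = 1) (x x' : Fin 3 → ℝ) (u : Fin 4 → ℝ) :
    pairing (anticomm (stdLambda g x') (stdTangent g u)) (stdLambda g x) = 0 := by
  rw [pairing_comm, pairing_lambda_anticomm h1]

/-- The basis `(Ω₁, Ω₂, Ω₃)` of the anti-self-dual 2-forms in coordinates. -/
def asdBasis (u v : Fin 4 → ℝ) : Fin 3 → ℝ :=
  ![-(u 0 * v 1 - u 1 * v 0) + (u 2 * v 3 - u 3 * v 2),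
    -(u 0 * v 3 - u 3 * v 0) + (u 1 * v 2 - u 2 * v 1),
    (u 0 * v 2 - u 2 * v 0) - (u 3 * v 1 - u 1 * v 3)]

/-- This is the second fundamental form contribution. The first summand is symmetric under
exchanging `u` and `u'` and drops out of the exterior derivative; the second produces the
Levi-Civita curvature. -/
theorem pairing_anticomm_anticomm {g : CMat} (h1 : gᴴ * g = 1) (x x' : Fin 3 → ℝ)
    (u u' : Fin 4 → ℝ) :
    pairing (anticomm (stdLambda g x) (stdTangent g u))
        (anticomm (stdLambda g x') (stdTangent g u')) =
      (x 0 * x' 0 + x 1 * x' 1 + x 2 * x' 2) *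
          (u 0 * u' 0 + u 1 * u' 1 + u 2 * u' 2 + u 3 * u' 3) +
        ((x 1 * x' 2 - x 2 * x' 1) * asdBasis u u' 0 + (x 2 * x' 0 - x 0 * x' 2) * asdBasis u u' 1 +
          (x 0 * x' 1 - x 1 * x' 0) * asdBasis u u' 2) := by
  rw [anticomm_std h1, anticomm_std h1, pairing_conj h1, pairing_apply]
  simp [pauli, baseTangent, anticomm, asdBasis, Matrix.trace, Fin.sum_univ_three]
  ring

theorem asdBasis_swap (u v : Fin 4 → ℝ) (m : Fin 3) : asdBasis v u m = -asdBasis u v m := by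
  fin_cases m <;> simp [asdBasis] <;> ring

/-- The point of `P` over the line `g e₀` with frame `g e₁`, `g e₂` and fibre coordinates `y`. -/
noncomputable def framePoint (g : CMat) (y : Fin 3 → ℝ) : FrameSpace :=
  (g * Matrix.diagonal ![1, 0, 0] * gᴴ, stdLambda g y, fun j => stdLambda g (Pi.single j 1))

/-- The tangent vector of `P` at `framePoint g y` with horizontal part `u`, rotation part `a`
(`a j` is the derivative of the `j`-th frame vector) and covariant derivative `D` of `y`. -/
noncomputable def frameTangent (g : CMat) (y : Fin 3 → ℝ) (u : Fin 4 → ℝ) (a : Fin 3 → Fin 3 → ℝ)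
    (D : Fin 3 → ℝ) : FrameSpace :=
  (stdTangent g u, stdLambda g D - anticomm (stdLambda g y) (stdTangent g u),
    fun j => stdLambda g (a j) - anticomm (stdLambda g (Pi.single j 1)) (stdTangent g u))

/-- The isomorphism `ℝ³ ≅ 𝔰𝔬(3)` with `T₁, T₂, T₃` twice the images of the basis vectors. -/
def hat (x : Fin 3 → ℝ) : RMat := !![0, x 2, -x 1; -x 2, 0, x 0; x 1, -x 0, 0]

/-- The combination `2 Ωₘ + (D × D')ₘ / (1 + s²)` of 2-forms on `X`. -/
noncomputable def instantonTwoForm (y : Fin 3 → ℝ) (u u' : Fin 4 → ℝ) (D D' : Fin 3 → ℝ) :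
    Fin 3 → ℝ := fun m => 2 * asdBasis u u' m +
      ![D 1 * D' 2 - D 2 * D' 1, D 2 * D' 0 - D 0 * D' 2, D 0 * D' 1 - D 1 * D' 0] m /
        (1 + (y 0 ^ 2 + y 1 ^ 2 + y 2 ^ 2))

/-- The left side is the coefficient of Dy ∧ Dy in the curvature: 2h comes from the exterior
derivative of h y ∧ Dy and -u h² from the quadratic term. -/
theorem profile_relation {u : ℝ} (hu : 0 ≤ u) :
    2 * profile u - u * profile u ^ 2 = 1 / (1 + u) := by
  have h : (0 : ℝ) < 1 + u := by linarith
  have h3 : (0 : ℝ) < √(1 + u) := Real.sqrt_pos.2 h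
  simp only [profile]
  set r := √(1 + u) with hr
  have h5 : 1 + u = r ^ 2 := (Real.sq_sqrt h.le).symm
  have h6 : u = r ^ 2 - 1 := by linarith
  rw [h5, h6]
  field_simp
  ring

/-- This is the factor multiplying the components of the connection transverse to the direction of
y. -/
theorem one_sub_mul_profile {u : ℝ} (hu : 0 ≤ u) : 1 - u * profile u = 1 / √(1 + u) := by
  have h : (0 : ℝ) < 1 + u := by linarith
  have h3 : (0 : ℝ) < √(1 + u) := Real.sqrt_pos.2 h
  simp only [profile]
  set r := √(1 + u) with hr
  have h5 : 1 + u = r ^ 2 := (Real.sq_sqrt h.le).symm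
  have h6 : u = r ^ 2 - 1 := by linarith
  rw [h5, h6]
  field_simp
  ring

/-! ### Connection and curvature in adapted frame coordinates. -/

theorem connEntry_frameTangent {g : CMat} (h1 : gᴴ * g = 1) (y : Fin 3 → ℝ) (u : Fin 4 → ℝ)
    {a : Fin 3 → Fin 3 → ℝ} (ha : ∀ i j, a i j = -a j i) (D : Fin 3 → ℝ) (i j : Fin 3) :
    connEntry i j (framePoint g y) (frameTangent g y u a D) =
      a j i + profile (y 0 ^ 2 + y 1 ^ 2 + y 2 ^ 2) * (y i * D j - y j * D i) := by
  have hs := pairing_frame_lambda h1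
  rw [connEntry_apply]
  simp only [framePoint, frameTangent, map_sub, hs, pairing_lambda_anticomm h1, pairing_lambda h1,
    sub_zero]
  rw [ha i j]
  ring_nf

/-- The rotation parts `a`, `a'` cancel, as they must for a horizontal form; what remains depends
only on the three forms of `instantonTwoForm`. -/
theorem curvature_conn {g : CMat} (h1 : gᴴ * g = 1) (y : Fin 3 → ℝ) (u u' : Fin 4 → ℝ)
    {a a' : Fin 3 → Fin 3 → ℝ} (ha : ∀ i j, a i j = -a j i) (ha' : ∀ i j, a' i j = -a' j i)
    (D D' : Fin 3 → ℝ) :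
    curvature conn (framePoint g y) (frameTangent g y u a D) (frameTangent g y u' a' D') =
      hat (fun m => (1 - (y 0 ^ 2 + y 1 ^ 2 + y 2 ^ 2) * profile (y 0 ^ 2 + y 1 ^ 2 + y 2 ^ 2)) *
          instantonTwoForm y u u' D D' m +
        profile (y 0 ^ 2 + y 1 ^ 2 + y 2 ^ 2) * (y 0 * instantonTwoForm y u u' D D' 0 +
          y 1 * instantonTwoForm y u u' D D' 1 + y 2 * instantonTwoForm y u u' D D' 2) * y m) := by
  have hs := pairing_frame_lambda h1
  have hyy : pairing (stdLambda g y) (stdLambda g y) = y 0 ^ 2 + y 1 ^ 2 + y 2 ^ 2 := by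
    rw [pairing_lambda h1]; ring
  have hp : 0 ≤ pairing (framePoint g y).2.1 (framePoint g y).2.1 := by
    show 0 ≤ pairing (stdLambda g y) (stdLambda g y)
    rw [hyy]; positivity
  have hrel := profile_relation (u := y 0 ^ 2 + y 1 ^ 2 + y 2 ^ 2) (by positivity)
  have d0 : ∀ i, a i i = 0 := fun i => by linarith [ha i i]
  have d0' : ∀ i, a' i i = 0 := fun i => by linarith [ha' i i]
  ext i j
  rw [curvature, extDeriv_one_apply ((contDiffAt_conn hp).differentiableAt (by simp))]
  simp only [Matrix.add_apply, Matrix.sub_apply, Matrix.mul_apply, fderiv_conn hp, conn_apply,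
    connEntry_frameTangent h1 y _ ha, connEntry_frameTangent h1 y _ ha', Fin.sum_univ_three]
  simp only [framePoint, frameTangent, map_sub, sub_apply, hs, pairing_lambda_anticomm h1,
    pairing_anticomm_lambda h1, pairing_anticomm_anticomm h1, pairing_lambda h1, sub_zero, zero_sub,
    instantonTwoForm, div_eq_mul_inv, mul_inv]
  rw [one_div] at hrel
  simp only [← sq] at hrel ⊢
  generalize profile (y 0 ^ 2 + y 1 ^ 2 + y 2 ^ 2) = h at hrel ⊢
  generalize (1 + (y 0 ^ 2 + y 1 ^ 2 + y 2 ^ 2))⁻¹ = q at hrel ⊢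
  -- Replacing 1 / (1 + s²) by 2h - s² h² leaves a polynomial identity in which h is a free
  -- variable.
  subst hrel
  simp only [asdBasis_swap u u']
  generalize asdBasis u u' = w
  have e01 := ha 0 1
  have e02 := ha 0 2
  have e12 := ha 1 2
  have e01' := ha' 0 1
  have e02' := ha' 0 2
  have e12' := ha' 1 2
  fin_cases i <;> fin_cases j <;>
    simp [hat, d0, d0', e01, e02, e12, e01', e02', e12'] <;> ring

/-! ### Euler angles -/

/-- The rotation of `ℝ³` about the first axis. -/
noncomputable def axisRot (a : ℝ) : RMat :=
  !![1, 0, 0; 0, Real.cos a, Real.sin a; 0, -Real.sin a, Real.cos a]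

/-- The rotation of `ℝ³` about the third axis. -/
noncomputable def planeRot (b : ℝ) : RMat :=
  !![Real.cos b, -Real.sin b, 0; Real.sin b, Real.cos b, 0; 0, 0, 1]

theorem exists_angle {x y : ℝ} (h : x ^ 2 + y ^ 2 = 1) :
    ∃ a, Real.cos a = x ∧ Real.sin a = y := by
  have hn : ‖(⟨x, y⟩ : ℂ)‖ = 1 := by
    rw [← sq_eq_sq₀ (norm_nonneg _) zero_le_one, Complex.sq_norm, Complex.normSq_mk]
    linarith
  have hz : (⟨x, y⟩ : ℂ) ≠ 0 := by
    intro h0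
    rw [h0, norm_zero] at hn
    exact zero_ne_one hn
  refine ⟨Complex.arg ⟨x, y⟩, ?_, ?_⟩
  · rw [Complex.cos_arg hz, hn, div_one]
  · rw [Complex.sin_arg, hn, div_one]

/-- A unit row and column through the corner entry leave room only for zeros, and the remaining
block is a rotation of the plane. -/
theorem exists_eq_axisRot {M : RMat} (hMM : M * Mᵀ = 1) (hMdet : M.det = 1) (c0 : M 0 0 = 1) :
    ∃ c, M = axisRot c := by
  have hMM' : Mᵀ * M = 1 := mul_eq_one_comm.1 hMM
  have col := congrFun (congrFun hMM' 0) 0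
  have row := congrFun (congrFun hMM 0) 0
  have q1 := congrFun (congrFun hMM' 1) 1
  have q2 := congrFun (congrFun hMM' 1) 2
  rw [Matrix.det_fin_three] at hMdet
  simp only [Matrix.mul_apply, Matrix.transpose_apply, Fin.sum_univ_three, c0, Matrix.one_apply_eq,
    ← sq] at col row q1
  simp only [Matrix.mul_apply, Matrix.transpose_apply, Fin.sum_univ_three] at q2
  rw [Matrix.one_apply_ne (by decide)] at q2
  have hz : ∀ x y : ℝ, 1 ^ 2 + x ^ 2 + y ^ 2 = 1 → x = 0 ∧ y = 0 := fun x y h =>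
    ⟨pow_eq_zero_iff two_ne_zero |>.1 (by linarith [sq_nonneg x, sq_nonneg y]),
      pow_eq_zero_iff two_ne_zero |>.1 (by linarith [sq_nonneg x, sq_nonneg y])⟩
  obtain ⟨m10, m20⟩ := hz _ _ col
  obtain ⟨m01, m02⟩ := hz _ _ row
  rw [c0, m10, m20, m01, m02] at hMdet
  rw [m01] at q1
  rw [m01, m02] at q2
  have m22 : M 2 2 = M 1 1 := by
    linear_combination -M 2 2 * q1 + M 2 1 * q2 + M 1 1 * hMdet
  have m21 : M 2 1 = -M 1 2 := by
    linear_combination -M 1 2 * q1 + M 1 1 * q2 - M 2 1 * hMdet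
  obtain ⟨c, hc1, hc2⟩ := exists_angle (x := M 1 1) (y := M 1 2) (by
    rw [m21] at q1; linarith)
  refine ⟨c, ?_⟩
  ext i j
  fin_cases i <;> fin_cases j <;> simp [axisRot, c0, m10, m20, m01, m02, m22, m21, hc1, hc2]

theorem exists_euler_angles {K : RMat} (hK : K ∈ Matrix.specialOrthogonalGroup (Fin 3) ℝ) :
    ∃ a b c, K = axisRot a * planeRot b * axisRot c := by
  obtain ⟨hO, hdet⟩ := Matrix.mem_specialOrthogonalGroup_iff.1 hK
  have hKK : Kᵀ * K = 1 := (Matrix.mem_orthogonalGroup_iff' _ _).1 hO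
  have hKK' : K * Kᵀ = 1 := (Matrix.mem_orthogonalGroup_iff _ _).1 hO
  have hu : K 0 0 ^ 2 + K 1 0 ^ 2 + K 2 0 ^ 2 = 1 := by
    have h := congrFun (congrFun hKK 0) 0
    simp [Matrix.mul_apply, Fin.sum_univ_three] at h
    linarith
  set r := √(K 1 0 ^ 2 + K 2 0 ^ 2) with hr
  have hr2 : r ^ 2 = K 1 0 ^ 2 + K 2 0 ^ 2 := Real.sq_sqrt (by positivity)
  -- The angles are read off from the first column of K, which has to be (cos b, sin b cos a, -sin b
  -- sin a).
  obtain ⟨b, hb1, hb2⟩ := exists_angle (x := K 0 0) (y := r) (by linarith)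
  -- If r = 0, the first column lies on the axis and `a` is arbitrary.
  obtain ⟨a, ha1, ha2⟩ : ∃ a, r * Real.cos a = K 1 0 ∧ r * Real.sin a = -K 2 0 := by
    by_cases h0 : r = 0
    · have h1 : K 1 0 ^ 2 + K 2 0 ^ 2 = 0 := by rw [← hr2, h0]; ring
      have h2 : K 1 0 = 0 := by nlinarith [sq_nonneg (K 1 0), sq_nonneg (K 2 0)]
      have h3 : K 2 0 = 0 := by nlinarith [sq_nonneg (K 1 0), sq_nonneg (K 2 0)]
      exact ⟨0, by simp [h0, h2], by simp [h0, h3]⟩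
    · obtain ⟨a, h1, h2⟩ := exists_angle (x := K 1 0 / r) (y := -K 2 0 / r) (by
        field_simp
        linarith)
      exact ⟨a, by rw [h1]; field_simp, by rw [h2]; field_simp⟩
  have ea := Real.sin_sq_add_cos_sq a
  have eb := Real.sin_sq_add_cos_sq b
  have hR : (axisRot a * planeRot b) * (axisRot a * planeRot b)ᵀ = 1 := by
    ext i j
    fin_cases i <;> fin_cases j <;>
      simp [axisRot, planeRot, Matrix.mul_apply, Fin.sum_univ_three, Matrix.transpose_apply] <;>
      first
        | ring1
        | linear_combination eb
        | linear_combination ea + Real.cos a ^ 2 * eb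
        | linear_combination ea + Real.sin a ^ 2 * eb
        | linear_combination Real.cos a * Real.sin a * eb
        | linear_combination -Real.cos a * Real.sin a * eb
  have hRdet : (axisRot a * planeRot b).det = 1 := by
    rw [Matrix.det_mul]
    simp [axisRot, planeRot, Matrix.det_fin_three]
    linear_combination (Real.sin b ^ 2 + Real.cos b ^ 2) * ea + eb
  -- The first two rotations carry e₀ to the first column of K, so the quotient fixes e₀.
  obtain ⟨M, hM⟩ : ∃ M, M = (axisRot a * planeRot b)ᵀ * K := ⟨_, rfl⟩
  have hKM : K = (axisRot a * planeRot b) * M := by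
    rw [hM, ← mul_assoc, hR, one_mul]
  have hMM : M * Mᵀ = 1 := by
    rw [hM, Matrix.transpose_mul _ K, Matrix.transpose_transpose]
    calc (axisRot a * planeRot b)ᵀ * K * (Kᵀ * (axisRot a * planeRot b))
        = (axisRot a * planeRot b)ᵀ * (K * Kᵀ) * (axisRot a * planeRot b) := by noncomm_ring
      _ = 1 := by rw [hKK', mul_one, mul_eq_one_comm.1 hR]
  have hMdet : M.det = 1 := by
    rw [hM, Matrix.det_mul, Matrix.det_transpose, hRdet, hdet, one_mul]
  have c0 : M 0 0 = 1 := by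
    rw [hM]
    simp [axisRot, planeRot, Matrix.mul_apply, Fin.sum_univ_three, Matrix.transpose_apply]
    rw [hb1, hb2]
    linear_combination hu + (K 1 0) * ha1 - (K 2 0) * ha2
  obtain ⟨c, hc⟩ := exists_eq_axisRot hMM hMdet c0
  exact ⟨a, b, c, by rw [hKM, hc]⟩

/-! ### Unitary matrices which act on the Pauli matrices by rotations -/

/-- The phase `diag(e^{-ia}, e^{ia}, 1)`. -/
noncomputable def phase (a : ℝ) : CMat :=
  !![⟨Real.cos a, -Real.sin a⟩, 0, 0; 0, ⟨Real.cos a, Real.sin a⟩, 0; 0, 0, 1]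

/-- The rotation by `b` in the plane of `e₁` and `e₂`. -/
noncomputable def planar (b : ℝ) : CMat :=
  !![1, 0, 0; 0, ⟨Real.cos b, 0⟩, ⟨-Real.sin b, 0⟩; 0, ⟨Real.sin b, 0⟩, ⟨Real.cos b, 0⟩]

/-- `w` is unitary, preserves the line of `e₀` and acts on the Pauli matrices by `K`. -/
structure ActsBy (w : CMat) (K : RMat) : Prop where
  left : wᴴ * w = 1
  line : w * Matrix.diagonal ![1, 0, 0] * wᴴ = Matrix.diagonal ![1, 0, 0]
  pauli : ∀ x, w * pauli x * wᴴ = BSInstanton.pauli (K *ᵥ x)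

theorem ActsBy.mul {w w' : CMat} {K K' : RMat} (h : ActsBy w K) (h' : ActsBy w' K') :
    ActsBy (w * w') (K * K') := by
  have hc : ∀ M : CMat, (w * w') * M * (w * w')ᴴ = w * (w' * M * w'ᴴ) * wᴴ := by
    intro M
    rw [Matrix.conjTranspose_mul]; noncomm_ring
  refine ⟨?_, ?_, ?_⟩
  · rw [Matrix.conjTranspose_mul]
    calc w'ᴴ * wᴴ * (w * w') = w'ᴴ * (wᴴ * w) * w' := by noncomm_ring
      _ = 1 := by rw [h.left, mul_one, h'.left]
  · rw [hc, h'.line, h.line]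
  · intro x
    rw [hc, h'.pauli, h.pauli, Matrix.mulVec_mulVec]

/-- Only the phase of e₁ relative to e₂ acts on the Pauli matrices. The entry at e₀ normalizes the
determinant and matches the holonomy found in `reachable_phase`. -/
theorem actsBy_phase (a : ℝ) : ActsBy (phase a) (axisRot a) := by
  have e := Real.sin_sq_add_cos_sq a
  refine ⟨?_, ?_, ?_⟩
  · ext i j
    fin_cases i <;> fin_cases j <;>
      simp [phase, Matrix.mul_apply, Fin.sum_univ_three, Complex.ext_iff] <;>
      (try constructor) <;> linarith
  · ext i j
    fin_cases i <;> fin_cases j <;>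
      simp [phase, Matrix.mul_apply, Fin.sum_univ_three, Complex.ext_iff, diagonal_three] <;>
      (try constructor) <;> linarith
  · intro x
    ext i j
    fin_cases i <;> fin_cases j <;>
      simp [phase, pauli, axisRot, Matrix.mul_apply, Matrix.mulVec, dotProduct, Fin.sum_univ_three,
        Complex.ext_iff] <;>
      (try constructor) <;> first | ring1 | linear_combination x 0 * e

/-- The angle doubles because SU(2) → SO(3) is a double cover. -/
theorem actsBy_planar (b : ℝ) : ActsBy (planar b) (planeRot (2 * b)) := by
  have e := Real.sin_sq_add_cos_sq b
  refine ⟨?_, ?_, ?_⟩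
  · ext i j
    fin_cases i <;> fin_cases j <;>
      simp [planar, Matrix.mul_apply, Fin.sum_univ_three, Complex.ext_iff] <;>
      linarith
  · ext i j
    fin_cases i <;> fin_cases j <;>
      simp [planar, Matrix.mul_apply, Fin.sum_univ_three, diagonal_three]
  · intro x
    ext i j
    fin_cases i <;> fin_cases j <;>
      simp [planar, pauli, planeRot, Matrix.mul_apply, Matrix.mulVec, dotProduct,
        Fin.sum_univ_three, Complex.ext_iff, Real.sin_two_mul, Real.cos_two_mul] <;>
      (try constructor) <;> first
        | ring1
        | linear_combination x 0 * e
        | linear_combination -x 0 * e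
        | linear_combination x 1 * e
        | linear_combination -x 1 * e
        | linear_combination x 2 * e
        | linear_combination -x 2 * e

/-- Rotations lift to unitary matrices. The explicit factors matter: each is later realized as a
holonomy. -/
theorem exists_actsBy {K : RMat} (hK : K ∈ Matrix.specialOrthogonalGroup (Fin 3) ℝ) :
    ∃ a b c, ActsBy (phase a * planar b * phase c) K := by
  obtain ⟨a, b, c, rfl⟩ := exists_euler_angles hK
  refine ⟨a, b / 2, c, ((actsBy_phase a).mul ?_).mul (actsBy_phase c)⟩
  have h := actsBy_planar (b / 2)
  rwa [mul_div_cancel₀ _ (two_ne_zero)] at h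

/-! ### `P` consists of the points `framePoint g y` -/

theorem line_mem_CP2 {g : CMat} (h1 : gᴴ * g = 1) : g * Matrix.diagonal ![1, 0, 0] * gᴴ ∈ CP2 := by
  refine ⟨?_, ?_, ?_⟩
  · show _ᴴ = _
    rw [Matrix.conjTranspose_mul, Matrix.conjTranspose_mul, Matrix.conjTranspose_conjTranspose,
      mul_assoc]
    congr 2
    simp [diagonal_three, ← Matrix.ext_iff, Fin.forall_fin_succ]
  · rw [conj_mul_conj h1]
    congr 2
    ext i j
    fin_cases i <;> fin_cases j <;> simp [diagonal_three]
  · rw [Matrix.trace_mul_comm, ← mul_assoc, h1, one_mul]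
    simp [Matrix.trace, Fin.sum_univ_three]

theorem cross_std {g : CMat} (h1 : gᴴ * g = 1) (x x' : Fin 3 → ℝ) :
    cross (stdLambda g x) (stdLambda g x') =
      stdLambda g ![x 1 * x' 2 - x 2 * x' 1, x 2 * x' 0 - x 0 * x' 2, x 0 * x' 1 - x 1 * x' 0] := by
  rw [cross, stdLambda_eq, stdLambda_eq, stdLambda_eq, conj_mul_conj h1, conj_mul_conj h1,
    ← sub_mul, ← mul_sub, ← smul_mul_assoc, ← mul_smul_comm]
  congr 2
  ext i j
  fin_cases i <;> fin_cases j <;>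
    simp [pauli, Complex.ext_iff] <;>
    (try constructor) <;> ring

theorem framePoint_mem {g : CMat} (h1 : gᴴ * g = 1) (y : Fin 3 → ℝ) : framePoint g y ∈ P := by
  have h2 : g * gᴴ = 1 := mul_eq_one_comm.1 h1
  have hl : ∀ x, stdLambda g x ∈ LambdaMinus (g * Matrix.diagonal ![1, 0, 0] * gᴴ) := fun x =>
    (lambda_iff h1 h2).2 ⟨x, rfl⟩
  refine ⟨⟨line_mem_CP2 h1, hl y⟩, fun i => hl _, ?_, ?_⟩
  · intro i j
    show (stdLambda g _ * stdLambda g _).trace = _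
    rw [stdLambda_eq, stdLambda_eq, trace_conj2 h1]
    fin_cases i <;> fin_cases j <;>
      simp [pauli, Matrix.trace, Fin.sum_univ_three, Complex.ext_iff] <;> norm_num
  · show cross (stdLambda g _) (stdLambda g _) = stdLambda g _
    rw [cross_std h1]
    congr 1
    ext i
    fin_cases i <;> simp

theorem stdLambda_injective {g : CMat} (h1 : gᴴ * g = 1) : Function.Injective (stdLambda g) := by
  intro x x' h
  ext k
  rw [← pairing_frame_lambda h1 k x, h, pairing_frame_lambda h1]

/-- Right multiplication by w changes the frame over a fixed line: the columns of K are the new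
frame vectors in the old frame, and y are coordinates in the new one. -/
theorem framePoint_mul {g w : CMat} {K : RMat} (hw : ActsBy w K) (y : Fin 3 → ℝ) :
    framePoint (g * w) y =
      (g * Matrix.diagonal ![1, 0, 0] * gᴴ, stdLambda g (K *ᵥ y),
        fun j => stdLambda g fun i => K i j) := by
  have hc : ∀ M : CMat, (g * w) * M * (g * w)ᴴ = g * (w * M * wᴴ) * gᴴ := by
    intro M
    rw [Matrix.conjTranspose_mul]; noncomm_ring
  have hl : ∀ x, stdLambda (g * w) x = stdLambda g (K *ᵥ x) := by
    intro x
    rw [stdLambda_eq, hc, hw.pauli, stdLambda_eq]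
  rw [framePoint, hc, hw.line, hl]
  congr 2
  funext j
  rw [hl]
  congr 1
  ext i
  simp [Matrix.mulVec_single]

/-- A unitary matrix adapted to the line is corrected by a lift of the rotation that carries its
Pauli frame to the given one. -/
theorem exists_framePoint {p : FrameSpace} (hp : p ∈ P) :
    ∃ (g : CMat) (y : Fin 3 → ℝ), gᴴ * g = 1 ∧ p = framePoint g y := by
  obtain ⟨⟨hQ, hY⟩, hZ, horth, hcross⟩ := id hp
  obtain ⟨g, h1, h2, hg⟩ := exists_unitary hQ
  obtain ⟨Q, Y, Z⟩ := p
  simp only [proj] at hQ hY hZ horth hcross hg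
  subst hg
  obtain ⟨y, rfl⟩ := (lambda_iff h1 h2).1 hY
  choose x hx using fun j => (lambda_iff h1 h2).1 (hZ j)
  obtain rfl : Z = fun j => stdLambda g (x j) := funext hx
  have hxx : ∀ i j, x i 0 * x j 0 + x i 1 * x j 1 + x i 2 * x j 2 = if i = j then 1 else 0 := by
    intro i j
    rw [← pairing_lambda h1]
    exact pairing_frame hp i j
  rw [cross_std h1] at hcross
  have hc := stdLambda_injective h1 hcross
  obtain ⟨K, hK⟩ : ∃ K : RMat, K = Matrix.of fun i j => x j i := ⟨_, rfl⟩
  have hKK : Kᵀ * K = 1 := by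
    ext i j
    simp only [hK, Matrix.mul_apply, Matrix.transpose_apply, Matrix.of_apply, Fin.sum_univ_three,
      Matrix.one_apply]
    exact hxx i j
  -- The condition on `cross` says that the third column is the vector product of the first two.
  have hdet : K.det = 1 := by
    have c0 := congrFun hc 0
    have c1 := congrFun hc 1
    have c2 := congrFun hc 2
    simp only [Matrix.cons_val] at c0 c1 c2
    have h := hxx 2 2
    rw [if_pos rfl] at h
    simp only [hK, Matrix.det_fin_three, Matrix.of_apply]
    linear_combination h + x 2 0 * c0 + x 2 1 * c1 + x 2 2 * c2
  obtain ⟨a, b, c, hw⟩ := exists_actsBy (K := K) (Matrix.mem_specialOrthogonalGroup_iff.2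
    ⟨(Matrix.mem_orthogonalGroup_iff' _ _).2 hKK, hdet⟩)
  -- The same fibre point in the rotated frame has coordinates Kᵀ y.
  refine ⟨g * (phase a * planar b * phase c), Kᵀ *ᵥ y, ?_, ?_⟩
  · rw [Matrix.conjTranspose_mul]
    calc (phase a * planar b * phase c)ᴴ * gᴴ * (g * (phase a * planar b * phase c))
        = (phase a * planar b * phase c)ᴴ * (gᴴ * g) * (phase a * planar b * phase c) := by
          noncomm_ring
      _ = 1 := by rw [h1, mul_one, hw.left]
  · rw [framePoint_mul hw, Matrix.mulVec_mulVec, mul_eq_one_comm.1 hKK, Matrix.one_mulVec, hK]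
    rfl

/-! ### Tangent vectors of `P` -/

theorem hasDerivAt_conjTranspose {γ : ℝ → CMat} {M : CMat} {t : ℝ} (h : HasDerivAt γ M t) :
    HasDerivAt (fun t => (γ t)ᴴ) Mᴴ t :=
  (LinearMap.toContinuousLinearMap
    (Matrix.conjTransposeLinearEquiv (Fin 3) (Fin 3) ℝ ℂ).toLinearMap).hasFDerivAt.comp_hasDerivAt
      t h

theorem hasDerivAt_trace {γ : ℝ → CMat} {M : CMat} {t : ℝ} (h : HasDerivAt γ M t) :
    HasDerivAt (fun t => (γ t).trace) M.trace t :=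
  (LinearMap.toContinuousLinearMap
    (Matrix.traceLinearMap (Fin 3) ℝ ℂ)).hasFDerivAt.comp_hasDerivAt t h

/-- The covariant derivative of a section of `Λ²₋(ℂℙ²)` along a curve. -/
theorem exists_covariant_derivative {g : CMat} (h1 : gᴴ * g = 1) {q m : ℝ → CMat} {U V : CMat}
    (hq : ∀ t, q t ∈ CP2) (hm : ∀ t, m t ∈ LambdaMinus (q t)) (hqd : HasDerivAt q U 0)
    (hmd : HasDerivAt m V 0) (hq0 : q 0 = g * Matrix.diagonal ![1, 0, 0] * gᴴ) :
    ∃ x, V = stdLambda g x - anticomm (m 0) U := by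
  have hU : U ∈ tangentVectors CP2 (q 0) := ⟨q, hq, rfl, hqd⟩
  obtain ⟨hUh, hUe⟩ := (mem_tangentVectors_CP2 (hq 0)).1 hU
  obtain ⟨hMh, hMQ, hMt⟩ := hm 0
  have hQh : (q 0)ᴴ = q 0 := (hq 0).1
  have hQM : q 0 * m 0 = 0 := by
    have h := congrArg Matrix.conjTranspose hMQ
    rwa [Matrix.conjTranspose_mul, hMh.eq, hQh, Matrix.conjTranspose_zero] at h
  have hVh : Vᴴ = V :=
    (hasDerivAt_conjTranspose hmd).unique (by
      rw [show (fun t => (m t)ᴴ) = m from funext fun t => (hm t).1]; exact hmd)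
  have hVQ : V * q 0 + m 0 * U = 0 :=
    (hmd.mul hqd).unique (by
      rw [show m * q = fun _ => 0 from funext fun t => (hm t).2.1]; exact hasDerivAt_const _ _)
  have hVt : V.trace = 0 :=
    (hasDerivAt_trace hmd).unique (by
      rw [show (fun t => (m t).trace) = fun _ => 0 from funext fun t => (hm t).2.2]
      exact hasDerivAt_const _ _)
  -- Since U exchanges the line and its complement and m 0 kills the line, m 0 * U sees only the
  -- line. Adding the anticommutator therefore cancels precisely the off-diagonal part of V.
  have hMU : m 0 * U = m 0 * U * q 0 := by
    conv_lhs => rw [← hUe, mul_add, ← mul_assoc, hMQ, zero_mul, zero_add, ← mul_assoc]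
  have hMUt : (m 0 * U).trace = 0 := by
    rw [hMU, Matrix.trace_mul_comm, ← mul_assoc, hQM, zero_mul, Matrix.trace_zero]
  have hmem : V + anticomm (m 0) U ∈ LambdaMinus (g * Matrix.diagonal ![1, 0, 0] * gᴴ) := by
    rw [← hq0]
    refine ⟨?_, ?_, ?_⟩
    · show _ᴴ = _
      rw [anticomm, Matrix.conjTranspose_add, Matrix.conjTranspose_add, Matrix.conjTranspose_mul,
        Matrix.conjTranspose_mul, hVh, hMh.eq, hUh.eq, add_comm (U * m 0)]
    · rw [anticomm, add_mul, add_mul, ← hMU, mul_assoc U, hMQ, mul_zero, add_zero, hVQ]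
    · rw [anticomm, Matrix.trace_add, Matrix.trace_add, Matrix.trace_mul_comm U, hMUt, hVt]
      simp
  obtain ⟨x, hx⟩ := (lambda_iff h1 (mul_eq_one_comm.1 h1)).1 hmem
  exact ⟨x, by rw [← hx, add_sub_cancel_right]⟩

theorem exists_frameTangent {g : CMat} (h1 : gᴴ * g = 1) {y : Fin 3 → ℝ} {v : FrameSpace}
    (hv : v ∈ tangentVectors P (framePoint g y)) :
    ∃ u a D, (∀ i j, a i j = -a j i) ∧ v = frameTangent g y u a D := by
  obtain ⟨γ, hγ, h0, hd⟩ := hv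
  have hq : HasDerivAt (fun t => (γ t).1) v.1 0 := hd.fst
  have hY : HasDerivAt (fun t => (γ t).2.1) v.2.1 0 := hd.snd.fst
  have hZ : ∀ j, HasDerivAt (fun t => (γ t).2.2 j) (v.2.2 j) 0 := fun j =>
    hasDerivAt_pi.1 hd.snd.snd j
  have hq0 : (γ 0).1 = g * Matrix.diagonal ![1, 0, 0] * gᴴ := by rw [h0]; rfl
  have hU : v.1 ∈ tangentVectors CP2 (g * Matrix.diagonal ![1, 0, 0] * gᴴ) :=
    ⟨_, fun t => (hγ t).1.1, hq0, hq⟩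
  obtain ⟨u, hu⟩ := (tangent_iff h1 (mul_eq_one_comm.1 h1) (line_mem_CP2 h1)).1 hU
  obtain ⟨D, hD⟩ := exists_covariant_derivative h1 (fun t => (hγ t).1.1) (fun t => (hγ t).1.2) hq hY
    hq0
  choose a ha using fun j => exists_covariant_derivative h1 (fun t => (hγ t).1.1)
    (fun t => (hγ t).2.1 j) hq (hZ j) hq0
  simp only [h0, hu] at hD ha
  refine ⟨u, a, D, ?_, ?_⟩
  · intro i j
    -- Differentiating the orthonormality of the frame gives the skewness of `a`.
    have hb : HasDerivAt (fun t => ((γ t).2.2 i * (γ t).2.2 j).trace)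
        (v.2.2 i * (γ 0).2.2 j + (γ 0).2.2 i * v.2.2 j).trace 0 :=
      hasDerivAt_trace ((hZ i).mul (hZ j))
    have hz := hb.unique (by
      rw [show (fun t => ((γ t).2.2 i * (γ t).2.2 j).trace) = fun _ => if i = j then 2 else 0 from
        funext fun t => (hγ t).2.2.1 i j]
      exact hasDerivAt_const _ _)
    have hz2 : pairing (v.2.2 i) ((γ 0).2.2 j) + pairing ((γ 0).2.2 i) (v.2.2 j) = 0 := by
      rw [pairing_apply, pairing_apply, ← add_div, ← Complex.add_re, ← Matrix.trace_add, hz]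
      simp
    rw [pairing_comm, h0, ha, ha] at hz2
    simp only [framePoint, map_sub, pairing_frame_lambda h1, pairing_lambda_anticomm h1] at hz2
    linarith
  · rw [frameTangent, ← hu]
    refine Prod.ext rfl (Prod.ext ?_ (funext fun j => ?_))
    · exact hD.trans (by rw [hu]; rfl)
    · exact (ha j).trans (by rw [hu]; rfl)

/-! ### Infinitesimal unitary motions -/

/-- The rotation of `ℝ³` by which a skew-Hermitian matrix acts infinitesimally on the Pauli
matrices. -/
noncomputable def rotationPart (m : CMat) (x : Fin 3 → ℝ) : Fin 3 → ℝ :=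
  ![2 * (x 1 * (m 1 2).re - x 2 * (m 1 2).im),
    2 * (x 2 * (((m 1 1).im - (m 2 2).im) / 2) - x 0 * (m 1 2).re),
    2 * (x 0 * (m 1 2).im - x 1 * (((m 1 1).im - (m 2 2).im) / 2))]

/-- The coordinates of the motion of the line of `e₀` generated by a skew-Hermitian matrix. -/
def horizontalPart (m : CMat) : Fin 4 → ℝ :=
  ![(m 1 0).re, (m 1 0).im, (m 2 0).re, (m 2 0).im]

/-- The block of m on the complement of e₀ rotates the Pauli matrices; its off-diagonal blocks move
the line and yield the anticommutator correction. -/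
theorem commutator_pauli {m : CMat} (hm : mᴴ = -m) (x : Fin 3 → ℝ) :
    m * pauli x - pauli x * m =
      pauli (rotationPart m x) - anticomm (pauli x) (baseTangent (horizontalPart m)) := by
  have h : ∀ i j, star (m j i) = -m i j := fun i j => congrFun (congrFun hm i) j
  have hre : ∀ i j, (m j i).re = -(m i j).re := fun i j => congrArg Complex.re (h i j)
  have him : ∀ i j, (m j i).im = (m i j).im := fun i j => by
    have := congrArg Complex.im (h i j)
    simpa using this
  have r0 : ∀ i, (m i i).re = 0 := fun i => by linarith [hre i i]
  ext i j
  simp only [anticomm, Matrix.sub_apply, Matrix.add_apply, Matrix.mul_apply, Fin.sum_univ_three]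
  fin_cases i <;> fin_cases j <;>
    simp [pauli, rotationPart, horizontalPart, baseTangent, Complex.ext_iff,
      hre 1 0, hre 2 0, hre 1 2, him 1 0, him 2 0, him 1 2, r0] <;>
    (try constructor) <;> ring

theorem commutator_line {m : CMat} (hm : mᴴ = -m) :
    m * Matrix.diagonal ![1, 0, 0] - Matrix.diagonal ![1, 0, 0] * m =
      baseTangent (horizontalPart m) := by
  have h : ∀ i j, star (m j i) = -m i j := fun i j => congrFun (congrFun hm i) j
  have hre : ∀ i j, (m j i).re = -(m i j).re := fun i j => congrArg Complex.re (h i j)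
  have him : ∀ i j, (m j i).im = (m i j).im := fun i j => by
    have := congrArg Complex.im (h i j)
    simpa using this
  ext i j
  simp only [Matrix.sub_apply, Matrix.mul_apply, Fin.sum_univ_three]
  fin_cases i <;> fin_cases j <;>
    simp [horizontalPart, baseTangent, Complex.ext_iff, hre 1 0, hre 2 0, him 1 0, him 2 0]

/-! ### Curves and maps into `P` -/

/-- `pauli` as a continuous linear map. -/
noncomputable def pauliCLM : (Fin 3 → ℝ) →L[ℝ] CMat :=
  LinearMap.toContinuousLinearMap
    { toFun := pauli
      map_add' := fun x y => by
        ext i j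
        fin_cases i <;> fin_cases j <;> simp [pauli, Complex.ext_iff, add_comm]
      map_smul' := fun c x => by
        ext i j
        fin_cases i <;> fin_cases j <;> simp [pauli, Complex.ext_iff] }

@[simp] theorem pauliCLM_apply (x : Fin 3 → ℝ) : pauliCLM x = pauli x := rfl

/-- The conjugate transpose as a continuous real linear map. -/
noncomputable def conjTransposeCLM : CMat →L[ℝ] CMat :=
  LinearMap.toContinuousLinearMap
    (Matrix.conjTransposeLinearEquiv (Fin 3) (Fin 3) ℝ ℂ).toLinearMap

theorem contDiff_framePoint {E : Type*} [NormedAddCommGroup E] [NormedSpace ℝ E] {G : E → CMat}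
    {y : E → Fin 3 → ℝ} (hG : ContDiff ℝ ∞ G) (hy : ContDiff ℝ ∞ y) :
    ContDiff ℝ ∞ fun x => framePoint (G x) (y x) := by
  have hs : ContDiff ℝ ∞ fun x => (G x)ᴴ := conjTransposeCLM.contDiff.comp hG
  have hc : ∀ f : E → CMat, ContDiff ℝ ∞ f → ContDiff ℝ ∞ fun x => G x * f x * (G x)ᴴ :=
    fun f hf => (hG.mul hf).mul hs
  have h1 := hc _ (contDiff_const (c := Matrix.diagonal ![1, 0, 0]))
  have h2 := hc _ (pauliCLM.contDiff.comp hy)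
  have h3 : ContDiff ℝ ∞ fun x => fun j : Fin 3 => stdLambda (G x) (Pi.single j 1) :=
    contDiff_pi.2 fun j => hc _ (contDiff_const (c := pauli (Pi.single j 1)))
  exact h1.prodMk (h2.prodMk h3)

theorem skew_rotationPart (m : CMat) (i j : Fin 3) :
    rotationPart m (Pi.single i 1) j = -rotationPart m (Pi.single j 1) i := by
  fin_cases i <;> fin_cases j <;> simp [rotationPart]

/-- Differentiating the conjugation by G gives the commutator with m. The values at t are separate
variables, so that they may be supplied in simplified form. -/
theorem hasDerivAt_framePoint {G : ℝ → CMat} {m : CMat} {y : ℝ → Fin 3 → ℝ} {g : CMat}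
    {x η : Fin 3 → ℝ} {t : ℝ} (hg : G t = g) (hx : y t = x) (h1 : gᴴ * g = 1)
    (hG : HasDerivAt G (g * m) t) (hm : mᴴ = -m) (hy : HasDerivAt y η t) :
    HasDerivAt (fun t => framePoint (G t) (y t))
      (frameTangent g x (horizontalPart m) (fun j => rotationPart m (Pi.single j 1))
        (η + rotationPart m x)) t := by
  subst hg hx
  have hGs : HasDerivAt (fun t => (G t)ᴴ) (-(m * (G t)ᴴ)) t := by
    have h := hasDerivAt_conjTranspose hG
    rwa [Matrix.conjTranspose_mul, hm, neg_mul] at h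
  have hc : ∀ {f : ℝ → CMat} {f' : CMat}, HasDerivAt f f' t →
      HasDerivAt (fun t => G t * f t * (G t)ᴴ)
        (G t * f' * (G t)ᴴ + G t * (m * f t - f t * m) * (G t)ᴴ) t := by
    intro f f' hf
    refine ((hG.mul hf).mul hGs).congr_deriv ?_
    simp only [Pi.mul_apply]
    noncomm_ring
  refine HasDerivAt.prodMk ?_ (HasDerivAt.prodMk ?_ (hasDerivAt_pi.2 fun j => ?_))
  · refine (hc (hasDerivAt_const t _)).congr_deriv ?_
    rw [commutator_line hm, stdTangent_eq]
    simp
  · refine (hc (pauliCLM.hasFDerivAt.comp_hasDerivAt t hy)).congr_deriv ?_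
    show _ * pauliCLM η * _ + _ * (m * pauli (y t) - pauli (y t) * m) * _ = _
    rw [commutator_pauli hm, anticomm_std h1, stdLambda_eq, ← pauliCLM_apply (η + _), map_add,
      pauliCLM_apply, pauliCLM_apply]
    noncomm_ring
  · refine (hc (hasDerivAt_const t (pauli (Pi.single j 1)))).congr_deriv ?_
    rw [commutator_pauli hm, anticomm_std h1, stdLambda_eq]
    noncomm_ring

/-! ### The bundle isomorphism -/

/-- The gauge transformation `diag(1, 1, ε)` which exchanges the two signs. -/
noncomputable def signMat (ε : ℝ) : CMat := Matrix.diagonal ![1, 1, (ε : ℂ)]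

/-- The identification of `P_{α₂}` with the restriction of `P`. -/
noncomputable def extensionMap (ε : ℝ) (x : ℝ × CMat) : FrameSpace :=
  framePoint (x.2 * signMat ε) (Pi.single 0 x.1)

/-- For ε = -1 this is the half-turn about the first axis. The determinant is then -1, but adapted
frames only require unitarity. -/
theorem actsBy_signMat {ε : ℝ} (hε : ε * ε = 1) :
    ActsBy (signMat ε) !![1, 0, 0; 0, ε, 0; 0, 0, ε] := by
  refine ⟨?_, ?_, ?_⟩
  · ext i j
    fin_cases i <;> fin_cases j <;>
      simp [signMat, diagonal_three, Matrix.mul_apply, Fin.sum_univ_three, Complex.ext_iff, hε]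
  · ext i j
    fin_cases i <;> fin_cases j <;>
      simp [signMat, diagonal_three, Matrix.mul_apply, Fin.sum_univ_three]
  · intro x
    ext i j
    fin_cases i <;> fin_cases j <;>
      simp [signMat, diagonal_three, pauli, Matrix.mul_apply, Matrix.mulVec, dotProduct,
        Fin.sum_univ_three, Complex.ext_iff] <;>
      (try constructor) <;> first | ring1 | linear_combination x 0 * hε

theorem unitary_of_mem_SU3 {g : CMat} (hg : g ∈ SU3) : gᴴ * g = 1 :=
  Matrix.mem_unitaryGroup_iff'.1 (Matrix.mem_specialUnitaryGroup_iff.1 hg).1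

theorem unitary_mul {g w : CMat} (hg : gᴴ * g = 1) (hw : wᴴ * w = 1) : (g * w)ᴴ * (g * w) = 1 := by
  rw [Matrix.conjTranspose_mul]
  calc wᴴ * gᴴ * (g * w) = wᴴ * (gᴴ * g) * w := by noncomm_ring
    _ = 1 := by rw [hg, mul_one, hw]

theorem actsBy_torus {t : CMat} (ht : t ∈ torus) : ActsBy t (expAlpha t) := by
  obtain ⟨hSU, hdiag⟩ := ht
  have h1 := unitary_of_mem_SU3 hSU
  have hz : ∀ i j, i ≠ j → t i j = 0 := fun i j h => hdiag h
  have z01 := hz 0 1 (by decide)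
  have z02 := hz 0 2 (by decide)
  have z10 := hz 1 0 (by decide)
  have z12 := hz 1 2 (by decide)
  have z20 := hz 2 0 (by decide)
  have z21 := hz 2 1 (by decide)
  have hn : ∀ i, (t i i).re * (t i i).re + (t i i).im * (t i i).im = 1 := by
    intro i
    have h := congrArg Complex.re (congrFun (congrFun h1 i) i)
    fin_cases i <;>
      simpa [Matrix.mul_apply, Fin.sum_univ_three, z01, z02, z10, z12, z20, z21] using h
  refine ⟨h1, ?_, ?_⟩
  · ext i j
    simp only [Matrix.mul_apply, Fin.sum_univ_three]
    fin_cases i <;> fin_cases j <;>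
      simp [z01, z02, z10, z20, Complex.ext_iff, hn]
    ring
  · intro x
    ext i j
    simp only [Matrix.mul_apply, Fin.sum_univ_three]
    fin_cases i <;> fin_cases j <;>
      simp [pauli, expAlpha, Matrix.mulVec, dotProduct, Fin.sum_univ_three, z01, z02, z10, z12, z20,
        z21, Complex.ext_iff] <;>
      (try constructor) <;> first
        | ring1
        | linear_combination x 0 * hn 1
        | linear_combination -x 0 * hn 2

theorem stdLambda_eq_sum (g : CMat) (x : Fin 3 → ℝ) :
    stdLambda g x = ∑ i, x i • stdLambda g (Pi.single i 1) := by
  have h : pauli x = x 0 • pauli (Pi.single 0 1) + x 1 • pauli (Pi.single 1 1) +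
      x 2 • pauli (Pi.single 2 1) := by
    ext i j
    fin_cases i <;> fin_cases j <;> simp [pauli, Complex.ext_iff]
  simp only [Fin.sum_univ_three, stdLambda_eq]
  rw [h]
  simp only [mul_add, add_mul, mul_smul_comm, smul_mul_assoc]

theorem act_framePoint {w : CMat} {K : RMat} (hw : ActsBy w K) (g : CMat) {y : Fin 3 → ℝ}
    (hy : K *ᵥ y = y) : framePoint (g * w) y = act (framePoint g y) K := by
  have h : (fun j => stdLambda g fun i => K i j) =
      fun j => ∑ i, K i j • stdLambda g (Pi.single i 1) :=
    funext fun j => stdLambda_eq_sum g fun i => K i j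
  rw [framePoint_mul hw, hy, h, act, framePoint]

theorem isExtension_extensionMap {ε : ℝ} (hε : ε * ε = 1) : IsExtension (extensionMap ε) where
  smooth s _ g _ := by
    have h1 : ContDiff ℝ ∞ (fun x : ℝ × CMat => x.2 * signMat ε) :=
      contDiff_snd.mul contDiff_const
    have h2 : ContDiff ℝ ∞ (fun x : ℝ × CMat => (Pi.single 0 x.1 : Fin 3 → ℝ)) :=
      (ContinuousLinearMap.single ℝ (fun _ : Fin 3 => ℝ) 0).contDiff.comp contDiff_fst
    exact (contDiff_framePoint h1 h2).contDiffAt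
  mem s _ g hg := framePoint_mem (unitary_mul (unitary_of_mem_SU3 hg) (actsBy_signMat hε).left) _
  covers s _ g _ := by
    rw [extensionMap, framePoint_mul (actsBy_signMat hε)]
    simp only [proj, twistorPoint, stdLambda_eq]
    congr 1
    rw [← smul_mul_assoc, ← mul_smul_comm]
    congr 2
    ext i j
    fin_cases i <;> fin_cases j <;>
      simp [pauli, diagonal_three, Matrix.mulVec, dotProduct, Fin.sum_univ_three, Complex.ext_iff]
  equivariant s _ g _ t ht := by
    -- The gauge transformation is diagonal, so it commutes with the torus and preserves
    -- equivariance.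
    have hcomm : t * signMat ε = signMat ε * t := by
      have hd : t = Matrix.diagonal (Matrix.diag t) := (Matrix.IsDiag.diagonal_diag ht.2).symm
      rw [hd, signMat, Matrix.diagonal_mul_diagonal, Matrix.diagonal_mul_diagonal]
      congr 1
      funext i
      exact mul_comm _ _
    rw [extensionMap, mul_assoc, hcomm, ← mul_assoc]
    -- The fibre coordinate (s, 0, 0) lies on the axis fixed by `expAlpha`.
    refine act_framePoint (actsBy_torus ht) _ ?_
    ext i
    fin_cases i <;> simp [expAlpha, Matrix.mulVec, dotProduct, Fin.sum_univ_three]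

/-! ### The connection and its curvature on `ℝ⁺ × SU(3)` -/

theorem mc_skew {g a : CMat} (ha : a ∈ tangentVectors SU3 g) : (gᴴ * a)ᴴ = -(gᴴ * a) := by
  obtain ⟨γ, hγ, h0, hd⟩ := ha
  have h := (hasDerivAt_conjTranspose hd).mul hd
  rw [show (fun t => (γ t)ᴴ) * γ = fun _ => 1 from
    funext fun t => unitary_of_mem_SU3 (hγ t)] at h
  have h2 := h.unique (hasDerivAt_const _ _)
  rw [h0] at h2
  rw [Matrix.conjTranspose_mul, Matrix.conjTranspose_conjTranspose]
  exact eq_neg_of_add_eq_zero_left h2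

/-- The Maurer–Cartan form in the gauge `signMat ε`. -/
theorem signMat_conj_apply (ε : ℝ) (m : CMat) (i j : Fin 3) :
    (signMat ε * m * signMat ε) i j =
      (![1, 1, (ε : ℂ)] : Fin 3 → ℂ) i * m i j * (![1, 1, (ε : ℂ)] : Fin 3 → ℂ) j := by
  rw [signMat, Matrix.mul_diagonal, Matrix.diagonal_mul]

theorem signMat_conj_skew (ε : ℝ) {m : CMat} (hm : mᴴ = -m) :
    (signMat ε * m * signMat ε)ᴴ = -(signMat ε * m * signMat ε) := by
  have h : (signMat ε)ᴴ = signMat ε := by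
    rw [signMat, Matrix.diagonal_conjTranspose]
    congr 1
    ext i
    fin_cases i <;> simp
  rw [Matrix.conjTranspose_mul, Matrix.conjTranspose_mul, h, hm]
  noncomm_ring

theorem signMat_mul_self {ε : ℝ} (hε : ε * ε = 1) : signMat ε * signMat ε = 1 := by
  rw [signMat, Matrix.diagonal_mul_diagonal, ← Matrix.diagonal_one]
  congr 1
  ext i
  fin_cases i <;> simp [← Complex.ofReal_mul, hε]

theorem fderiv_extensionMap {ε : ℝ} (hε : ε * ε = 1) {g : CMat} (hg : g ∈ SU3) {s : ℝ} (hs : 0 < s)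
    {v : ℝ × CMat} (hv : v.2 ∈ tangentVectors SU3 g) {m : CMat}
    (hm : m = signMat ε * mc g v.2 * signMat ε) :
    fderiv ℝ (extensionMap ε) (s, g) v =
      frameTangent (g * signMat ε) (Pi.single 0 s) (horizontalPart m)
        (fun j => rotationPart m (Pi.single j 1))
        (Pi.single 0 v.1 + rotationPart m (Pi.single 0 s)) := by
  have h1 := unitary_of_mem_SU3 hg
  have hd := ((isExtension_extensionMap hε).smooth s hs g hg).differentiableAt (by simp)
  have hline : HasDerivAt (fun t : ℝ => (s, g) + t • v) v 0 := by
    simpa using ((hasDerivAt_id (0 : ℝ)).smul_const v).const_add (s, g)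
  have hl : HasDerivAt (fun t : ℝ => extensionMap ε ((s, g) + t • v))
      (fderiv ℝ (extensionMap ε) (s, g) v) 0 := by
    refine HasFDerivAt.comp_hasDerivAt (l := extensionMap ε) (0 : ℝ) ?_ hline
    simpa using hd.hasFDerivAt
  have h2 : HasDerivAt (fun t : ℝ => ((s, g) + t • v).2) v.2 0 := hline.snd
  have hG : HasDerivAt (fun t : ℝ => ((s, g) + t • v).2 * signMat ε) (v.2 * signMat ε) 0 :=
    h2.mul_const _
  have hy : HasDerivAt (fun t : ℝ => (Pi.single 0 ((s, g) + t • v).1 : Fin 3 → ℝ))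
      (Pi.single 0 v.1) 0 :=
    (ContinuousLinearMap.single ℝ (fun _ : Fin 3 => ℝ) 0).hasFDerivAt.comp_hasDerivAt 0 hline.fst
  have hG0 : (fun t : ℝ => ((s, g) + t • v).2 * signMat ε) 0 = g * signMat ε := by simp
  have hy0 : (fun t : ℝ => (Pi.single 0 ((s, g) + t • v).1 : Fin 3 → ℝ)) 0 = Pi.single 0 s := by
    simp
  -- In the gauge the velocity becomes left-invariant, with the conjugated Maurer–Cartan value m:
  -- its (1,2) entry, which carries ν₁ and ν₂, is multiplied by ε.
  have hvm : v.2 * signMat ε = g * signMat ε * m := by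
    rw [hm, mc]
    calc v.2 * signMat ε = (g * gᴴ) * v.2 * signMat ε := by rw [mul_eq_one_comm.1 h1, one_mul]
      _ = g * 1 * gᴴ * v.2 * signMat ε := by rw [mul_one]
      _ = g * signMat ε * (signMat ε * (gᴴ * v.2) * signMat ε) := by
        rw [← signMat_mul_self hε]; noncomm_ring
  exact hl.unique (hasDerivAt_framePoint hG0 hy0 (unitary_mul h1 (actsBy_signMat hε).left)
    (hvm ▸ hG) (by rw [hm]; exact signMat_conj_skew ε (mc_skew hv)) hy)

theorem conn_extensionMap {ε : ℝ} (hε : ε * ε = 1) {g : CMat} (hg : g ∈ SU3) {s : ℝ} (hs : 0 < s)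
    {v : ℝ × CMat} (hv : v.2 ∈ tangentVectors SU3 g) :
    conn (extensionMap ε (s, g)) ![fderiv ℝ (extensionMap ε) (s, g) v] =
      instantonForm ε s g v := by
  obtain ⟨m, hm⟩ : ∃ m, m = signMat ε * mc g v.2 * signMat ε := ⟨_, rfl⟩
  have h1 := unitary_mul (unitary_of_mem_SU3 hg) (actsBy_signMat hε).left
  have hprof := one_sub_mul_profile (sq_nonneg s)
  have hmij := fun i j => (congrFun (congrFun hm i) j).trans (signMat_conj_apply ε _ i j)
  have m12 : m 1 2 = mc g v.2 1 2 * ε := by rw [hmij]; simp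
  have m11 : m 1 1 = mc g v.2 1 1 := by rw [hmij]; simp
  have m22 : m 2 2 = mc g v.2 2 2 := by
    have hc : (ε : ℂ) * ε = 1 := by exact_mod_cast hε
    rw [hmij]
    simp only [Matrix.cons_val]
    linear_combination (mc g v.2 2 2) * hc
  ext i j
  rw [fderiv_extensionMap hε hg hs hv hm, conn_apply, extensionMap,
    connEntry_frameTangent h1 _ _ (fun i j => skew_rotationPart m i j), instantonForm]
  -- Trading the square root for 1 - s² h makes every entry polynomial.
  rw [div_eq_mul_one_div, ← hprof]
  fin_cases i <;> fin_cases j <;>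
    simp [rotationPart, T1, T2, T3, alpha, nu1, nu2, m12, m11, m22] <;> ring

theorem curvature_extensionMap {ε : ℝ} (hε : ε * ε = 1) {g : CMat} (hg : g ∈ SU3) {s : ℝ}
    (hs : 0 < s) {v w : ℝ × CMat} (hv : v.2 ∈ tangentVectors SU3 g)
    (hw : w.2 ∈ tangentVectors SU3 g) :
    curvature conn (extensionMap ε (s, g)) (fderiv ℝ (extensionMap ε) (s, g) v)
      (fderiv ℝ (extensionMap ε) (s, g) w) = instantonCurvature ε s g v w := by
  obtain ⟨m, hm⟩ : ∃ m, m = signMat ε * mc g v.2 * signMat ε := ⟨_, rfl⟩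
  obtain ⟨n, hn⟩ : ∃ n, n = signMat ε * mc g w.2 * signMat ε := ⟨_, rfl⟩
  have h1 := unitary_mul (unitary_of_mem_SU3 hg) (actsBy_signMat hε).left
  have hprof := one_sub_mul_profile (sq_nonneg s)
  have hmij := fun i j => (congrFun (congrFun hm i) j).trans (signMat_conj_apply ε _ i j)
  have hnij := fun i j => (congrFun (congrFun hn i) j).trans (signMat_conj_apply ε _ i j)
  have m12 : m 1 2 = mc g v.2 1 2 * ε := by rw [hmij]; simp
  have m10 : m 1 0 = mc g v.2 1 0 := by rw [hmij]; simp
  have m20 : m 2 0 = ε * mc g v.2 2 0 := by rw [hmij]; simp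
  have n12 : n 1 2 = mc g w.2 1 2 * ε := by rw [hnij]; simp
  have n10 : n 1 0 = mc g w.2 1 0 := by rw [hnij]; simp
  have n20 : n 2 0 = ε * mc g w.2 2 0 := by rw [hnij]; simp
  rw [fderiv_extensionMap hε hg hs hv hm, fderiv_extensionMap hε hg hs hw hn, extensionMap,
    curvature_conn h1 _ _ _ (fun i j => skew_rotationPart m i j)
      (fun i j => skew_rotationPart n i j), instantonCurvature]
  have hs2 : (0 : ℝ) < 1 + s ^ 2 := by positivity
  have hpow : s / (1 + s ^ 2) ^ (3 / 2 : ℝ) = s * (1 + s ^ 2)⁻¹ * (√(1 + s ^ 2))⁻¹ := by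
    rw [div_eq_mul_inv, mul_assoc, ← mul_inv, show (3 / 2 : ℝ) = 1 + 1 / 2 by norm_num, Real.rpow_add hs2, Real.rpow_one,
      ← Real.sqrt_eq_rpow]
  rw [hpow, add_comm (s ^ 2) 1]
  ext i j
  rcases mul_self_eq_one_iff.1 hε with rfl | rfl <;> fin_cases i <;> fin_cases j <;>
    simp [hat, instantonTwoForm, asdBasis, horizontalPart, rotationPart, T1, T2, T3, nu1, nu2,
      Omega1, Omega2, Omega3, ee, coframe, m12, m10, m20, n12, n10, n20] <;>
    first | ring1 | (rw [hprof]; ring1)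

/-! ### Horizontal paths and the holonomy group -/

/-- The curve `exp(t M)` for a skew-Hermitian matrix `M` with `M³ = -M`. -/
noncomputable def rodrigues (M : CMat) (t : ℝ) : CMat :=
  1 + Real.sin t • M + (1 - Real.cos t) • (M * M)

theorem rodrigues_unitary {M : CMat} (hM : Mᴴ = -M) (h3 : M * M * M = -M) (t : ℝ) :
    (rodrigues M t)ᴴ * rodrigues M t = 1 := by
  have h4 : M * M * (M * M) = -(M * M) := by rw [← mul_assoc, h3, neg_mul]
  have h3' : M * (M * M) = -M := by rw [← mul_assoc, h3]
  simp only [rodrigues, Matrix.conjTranspose_add, Matrix.conjTranspose_smul,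
    Matrix.conjTranspose_mul, Matrix.conjTranspose_one, hM, star_trivial, neg_mul_neg]
  simp only [add_mul, mul_add, smul_mul_assoc, mul_smul_comm, one_mul, mul_one, neg_mul, h3, h3',
    h4, smul_neg]
  match_scalars <;> first | ring1 | linear_combination -Real.sin_sq_add_cos_sq t

theorem hasDerivAt_rodrigues {M : CMat} (h3 : M * M * M = -M) (t : ℝ) :
    HasDerivAt (rodrigues M) (rodrigues M t * M) t := by
  have h := (((Real.hasDerivAt_sin t).smul_const M).const_add 1).add
    (((Real.hasDerivAt_cos t).const_sub 1).smul_const (M * M))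
  refine h.congr_deriv ?_
  simp only [rodrigues, add_mul, smul_mul_assoc, one_mul, h3]
  module

theorem contDiff_rodrigues (M : CMat) : ContDiff ℝ ∞ (rodrigues M) := by
  have h1 : ContDiff ℝ ∞ (fun t : ℝ => Real.sin t • M) := Real.contDiff_sin.smul contDiff_const
  have h2 : ContDiff ℝ ∞ (fun t : ℝ => (1 - Real.cos t) • (M * M)) :=
    (contDiff_const.sub Real.contDiff_cos).smul contDiff_const
  exact (contDiff_const.add h1).add h2

/-- With no rotation part the Levi-Civita term vanishes, and Dy is a multiple of y, so y ∧ Dy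
vanishes too. -/
theorem conn_frameTangent_eq_zero {g : CMat} (h1 : gᴴ * g = 1) {m : CMat} (y : Fin 3 → ℝ)
    (hrot : ∀ x, rotationPart m x = 0) (c : ℝ) :
    conn (framePoint g y) ![frameTangent g y (horizontalPart m)
      (fun j => rotationPart m (Pi.single j 1)) (c • y + rotationPart m y)] = 0 := by
  ext i j
  rw [conn_apply, connEntry_frameTangent h1 _ _ fun i j => skew_rotationPart m i j]
  simp only [hrot, add_zero, Pi.zero_apply, Pi.smul_apply, smul_eq_mul, Matrix.zero_apply]
  ring

/-- A generator without rotation part moves the line along a geodesic and carries the frame in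
parallel. The parameter is rescaled by θ to run over the unit interval. -/
theorem horizontalPath_zeroSection {g : CMat} (h1 : gᴴ * g = 1) {M : CMat} (hM : Mᴴ = -M)
    (h3 : M * M * M = -M) (hrot : ∀ x, rotationPart M x = 0) (θ : ℝ) :
    HorizontalPath conn (framePoint g 0) (framePoint (g * rodrigues M θ) 0) := by
  have hu : ∀ t, (g * rodrigues M (t * θ))ᴴ * (g * rodrigues M (t * θ)) = 1 := fun t =>
    unitary_mul h1 (rodrigues_unitary hM h3 _)
  have hsm : ContDiff ℝ ∞ fun t : ℝ => g * rodrigues M (t * θ) :=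
    contDiff_const.mul ((contDiff_rodrigues M).comp (contDiff_id.mul contDiff_const))
  refine ⟨fun t => framePoint (g * rodrigues M (t * θ)) 0, ?_, fun t => framePoint_mem (hu t) 0, ?_,
    ?_, by simp⟩
  · exact contDiff_framePoint hsm contDiff_const
  · intro t _
    have hrot' : ∀ x, rotationPart (θ • M) x = 0 := by
      intro x
      have h := fun i => congrFun (hrot x) i
      ext i
      have h0 := h 0
      have h1 := h 1
      have h2 := h 2
      simp [rotationPart] at h0 h1 h2
      fin_cases i <;> simp [rotationPart]
      · linear_combination θ * h0
      · linear_combination θ * h1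
      · linear_combination θ * h2
    have hd : HasDerivAt (fun t : ℝ => g * rodrigues M (t * θ))
        (g * rodrigues M (t * θ) * (θ • M)) t := by
      have h := HasDerivAt.scomp t (hasDerivAt_rodrigues h3 (t * θ))
        ((hasDerivAt_id t).mul_const θ)
      refine (h.const_mul g).congr_deriv ?_
      simp [mul_assoc]
    have hp := hasDerivAt_framePoint (G := fun t => g * rodrigues M (t * θ)) (y := fun _ => 0) rfl rfl
      (hu t) hd
      (by rw [Matrix.conjTranspose_smul, hM, star_trivial, smul_neg])
      (hasDerivAt_const t (0 : Fin 3 → ℝ))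
    rw [hp.deriv]
    simpa using conn_frameTangent_eq_zero (hu t) 0 hrot' 0
  · simp [rodrigues]

/-- The frame stays fixed and the velocity of y is parallel to y, so both terms of the connection
vanish. -/
theorem horizontalPath_radial {g : CMat} (h1 : gᴴ * g = 1) (y : Fin 3 → ℝ) (a b : ℝ) :
    HorizontalPath conn (framePoint g (a • y)) (framePoint g (b • y)) := by
  refine ⟨fun t => framePoint g ((a + t * (b - a)) • y), ?_, fun t => framePoint_mem h1 _, ?_,
    by simp, by simp⟩
  · have hs : ContDiff ℝ ∞ fun t : ℝ => (a + t * (b - a)) • y := by fun_prop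
    exact contDiff_framePoint contDiff_const hs
  · intro t _
    have hy : HasDerivAt (fun t : ℝ => (a + t * (b - a)) • y) ((b - a) • y) t := by
      simpa using (((hasDerivAt_id t).mul_const (b - a)).const_add a).smul_const y
    have hp := hasDerivAt_framePoint (G := fun _ => g) (m := 0) rfl rfl h1
      (by simpa using hasDerivAt_const t g) (by simp) hy
    have hrot : ∀ x, rotationPart 0 x = 0 := by
      intro x
      ext i
      fin_cases i <;> simp [rotationPart]
    rw [hp.deriv]
    ext i j
    rw [conn_apply, connEntry_frameTangent h1 _ _ fun i j => skew_rotationPart 0 i j]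
    simp only [hrot, add_zero, Pi.zero_apply, Pi.smul_apply, smul_eq_mul, Matrix.zero_apply]
    ring

/-- Right multiplication by `w` is realized by horizontal paths along the zero section. -/
def Reachable (w : CMat) : Prop :=
  ∀ g : CMat, gᴴ * g = 1 →
    Relation.ReflTransGen (HorizontalPath conn) (framePoint g 0) (framePoint (g * w) 0)

/-- Since `Reachable` quantifies over all starting frames, concatenating paths corresponds to
multiplying matrices. -/
theorem Reachable.mul {w w' : CMat} (hw : wᴴ * w = 1) (h : Reachable w) (h' : Reachable w') :
    Reachable (w * w') := by
  intro g hg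
  rw [← mul_assoc]
  exact (h g hg).trans (h' _ (unitary_mul hg hw))

/-- The generator of the rotation of `e₀` to `c e₁`. -/
noncomputable def generatorOne (c : ℂ) : CMat := !![0, -starRingEnd ℂ c, 0; c, 0, 0; 0, 0, 0]

/-- The generator of the rotation of `e₀` to `e₂`. -/
noncomputable def generatorTwo : CMat := !![0, 0, -1; 0, 0, 0; 1, 0, 0]

theorem generatorOne_skew (c : ℂ) : (generatorOne c)ᴴ = -generatorOne c := by
  ext i j
  fin_cases i <;> fin_cases j <;> simp [generatorOne]

theorem generatorOne_cube {c : ℂ} (hc : starRingEnd ℂ c * c = 1) :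
    generatorOne c * generatorOne c * generatorOne c = -generatorOne c := by
  ext i j
  fin_cases i <;> fin_cases j <;> simp [generatorOne, Matrix.mul_apply, Fin.sum_univ_three]
  · linear_combination (starRingEnd ℂ c) * hc
  · linear_combination c * hc

theorem generatorTwo_skew : generatorTwoᴴ = -generatorTwo := by
  ext i j
  fin_cases i <;> fin_cases j <;> simp [generatorTwo]

theorem generatorTwo_cube : generatorTwo * generatorTwo * generatorTwo = -generatorTwo := by
  ext i j
  fin_cases i <;> fin_cases j <;> simp [generatorTwo, Matrix.mul_apply, Fin.sum_univ_three]

theorem rodrigues_generatorOne {c : ℂ} (hc : starRingEnd ℂ c * c = 1) (θ : ℝ) :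
    rodrigues (generatorOne c) θ =
      !![(Real.cos θ : ℂ), -(starRingEnd ℂ c * Real.sin θ), 0;
        c * Real.sin θ, (Real.cos θ : ℂ), 0; 0, 0, 1] := by
  ext i j
  simp only [rodrigues, Matrix.add_apply, Matrix.smul_apply, Matrix.mul_apply, Fin.sum_univ_three,
    Complex.real_smul]
  fin_cases i <;> fin_cases j <;> simp [generatorOne, -Complex.ofReal_cos, -Complex.ofReal_sin]
  · linear_combination -(1 - (Real.cos θ : ℂ)) * hc
  · ring
  · ring
  · linear_combination -(1 - (Real.cos θ : ℂ)) * hc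

theorem rodrigues_generatorTwo (θ : ℝ) :
    rodrigues generatorTwo θ =
      !![(Real.cos θ : ℂ), 0, -(Real.sin θ : ℂ); 0, 1, 0; (Real.sin θ : ℂ), 0, (Real.cos θ : ℂ)] := by
  ext i j
  simp only [rodrigues, Matrix.add_apply, Matrix.smul_apply, Matrix.mul_apply, Fin.sum_univ_three,
    Complex.real_smul]
  fin_cases i <;> fin_cases j <;> simp [generatorTwo]

theorem reachable_one {c : ℂ} (hc : starRingEnd ℂ c * c = 1) (θ : ℝ) :
    Reachable (rodrigues (generatorOne c) θ) := fun g hg =>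
  .single (horizontalPath_zeroSection hg (generatorOne_skew c) (generatorOne_cube hc)
    (fun x => by ext i; fin_cases i <;> simp [rotationPart, generatorOne]) θ)

theorem reachable_two (θ : ℝ) : Reachable (rodrigues generatorTwo θ) := fun g hg =>
  .single (horizontalPath_zeroSection hg generatorTwo_skew generatorTwo_cube
    (fun x => by ext i; fin_cases i <;> simp [rotationPart, generatorTwo]) θ)

/-- A lune in a complex projective line: from e₀ to its antipode e₁ along one geodesic and back
along another, whose directions differ by the phase c. -/
theorem reachable_phase (a : ℝ) : Reachable (phase a) := by
  have e := Real.sin_sq_add_cos_sq a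
  obtain ⟨c, hc⟩ : ∃ c : ℂ, c = ⟨Real.cos a, Real.sin a⟩ := ⟨_, rfl⟩
  have hcc : starRingEnd ℂ c * c = 1 := by
    rw [hc]
    simp [Complex.ext_iff]
    constructor <;> linarith
  have h : phase a = rodrigues (generatorOne c) (Real.pi / 2) *
      rodrigues (generatorOne 1) (-(Real.pi / 2)) := by
    rw [rodrigues_generatorOne hcc, rodrigues_generatorOne (by simp), hc]
    ext i j
    fin_cases i <;> fin_cases j <;> simp [phase, Complex.ext_iff]
  rw [h]
  exact (reachable_one hcc _).mul
    (rodrigues_unitary (generatorOne_skew c) (generatorOne_cube hcc) _)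
    (reachable_one (by simp) _)

/-- A geodesic triangle in a real projective plane, with vertices e₀, e₁ and cos b e₁ + sin b e₂. -/
theorem reachable_planar (b : ℝ) : Reachable (planar b) := by
  have h1 : starRingEnd ℂ 1 * 1 = 1 := by simp
  have h : planar b = rodrigues (generatorOne 1) (Real.pi / 2) * (rodrigues generatorTwo b *
      rodrigues (generatorOne 1) (-(Real.pi / 2))) := by
    rw [rodrigues_generatorOne h1, rodrigues_generatorOne h1, rodrigues_generatorTwo]
    ext i j
    fin_cases i <;> fin_cases j <;>
      simp [planar, Complex.ext_iff, -Complex.ofReal_cos, -Complex.ofReal_sin]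
  rw [h]
  exact (reachable_one h1 _).mul
    (rodrigues_unitary (generatorOne_skew 1) (generatorOne_cube h1) _)
    ((reachable_two b).mul (rodrigues_unitary generatorTwo_skew generatorTwo_cube _)
      (reachable_one h1 _))

/-- Go down a ray to the zero section, around a loop with the prescribed rotation, and back up a
ray. -/
theorem isIrreducibleConnection_conn : IsIrreducibleConnection conn := by
  intro p hp
  refine Set.Subset.antisymm (fun k hk => hk.1) fun k hk => ⟨hk, ?_⟩
  obtain ⟨g, y, h1, rfl⟩ := exists_framePoint hp
  obtain ⟨a, b, c, hw⟩ := exists_actsBy hk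
  have hr : Reachable (phase a * planar b * phase c) :=
    ((reachable_phase a).mul (actsBy_phase a).left (reachable_planar b)).mul
      ((actsBy_phase a).mul (actsBy_planar b)).left (reachable_phase c)
  obtain ⟨hO, -⟩ := Matrix.mem_specialOrthogonalGroup_iff.1 hk
  have hkk : k * kᵀ = 1 := (Matrix.mem_orthogonalGroup_iff _ _).1 hO
  have hact : act (framePoint g y) k =
      framePoint (g * (phase a * planar b * phase c)) (kᵀ *ᵥ y) := by
    have h : (fun j => stdLambda g fun i => k i j) =
        fun j => ∑ i, k i j • stdLambda g (Pi.single i 1) :=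
      funext fun j => stdLambda_eq_sum g fun i => k i j
    rw [framePoint_mul hw, Matrix.mulVec_mulVec, hkk, Matrix.one_mulVec, h, act, framePoint]
  have hin := horizontalPath_radial h1 y 1 0
  -- In the rotated frame the original point of X has coordinates kᵀ y, so the path ends over its
  -- starting point.
  have hout := horizontalPath_radial (unitary_mul h1 hw.left) (kᵀ *ᵥ y) 0 1
  rw [one_smul, zero_smul] at hin hout
  rw [hact]
  exact ((Relation.ReflTransGen.single hin).trans (hr g h1)).tail hout

/-! ### The instanton equation -/

/-- The value of `a ∧ b ∧ c ∧ d ∧ e ∧ f` on six vectors, where the covectors are given by their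
values on these vectors. -/
noncomputable def wedgeSix (a b c d e f : Fin 6 → ℝ) : ℝ := (Matrix.of ![a, b, c, d, e, f]).det

theorem sum_perm_six (a b c d e f : Fin 6 → ℝ) :
    ∑ σ : Equiv.Perm (Fin 6), ((Equiv.Perm.sign σ : ℤ) : ℝ) *
      (a (σ 0) * b (σ 1) * (c (σ 2) * d (σ 3)) * (e (σ 4) * f (σ 5))) = wedgeSix a b c d e f := by
  rw [wedgeSix, ← Matrix.det_transpose, Matrix.det_apply']
  refine Finset.sum_congr rfl fun σ _ => ?_
  simp only [Fin.prod_univ_six, Matrix.transpose_apply, Matrix.of_apply, Matrix.cons_val]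
  ring

/-- The value of `a ∧ b` on the `i`-th and `j`-th vectors. -/
def wedgeTwo (a b : Fin 6 → ℝ) (i j : Fin 6) : ℝ := a i * b j - a j * b i

theorem wedgeSix_swap {i j : Fin 6} (hij : i ≠ j) {a b c d e f a' b' c' d' e' f' : Fin 6 → ℝ}
    (h : ![a', b', c', d', e', f'] = ![a, b, c, d, e, f] ∘ Equiv.swap i j) :
    wedgeSix a' b' c' d' e' f' = -wedgeSix a b c d e f := by
  rw [wedgeSix, wedgeSix, h]
  have hd := Matrix.det_permute (Equiv.swap i j) (Matrix.of ![a, b, c, d, e, f])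
  rw [Equiv.Perm.sign_swap hij] at hd
  refine hd.trans ?_
  simp

section

variable (a b c d e f : Fin 6 → ℝ)

theorem wedgeSix_swap01 : wedgeSix b a c d e f = -wedgeSix a b c d e f :=
  wedgeSix_swap (show (0 : Fin 6) ≠ 1 by decide) (by funext k; fin_cases k <;> rfl)

theorem wedgeSix_swap23 : wedgeSix a b d c e f = -wedgeSix a b c d e f :=
  wedgeSix_swap (show (2 : Fin 6) ≠ 3 by decide) (by funext k; fin_cases k <;> rfl)

theorem wedgeSix_swap45 : wedgeSix a b c d f e = -wedgeSix a b c d e f :=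
  wedgeSix_swap (show (4 : Fin 6) ≠ 5 by decide) (by funext k; fin_cases k <;> rfl)

theorem wedgeSix_swap12 : wedgeSix a c b d e f = -wedgeSix a b c d e f :=
  wedgeSix_swap (show (1 : Fin 6) ≠ 2 by decide) (by funext k; fin_cases k <;> rfl)

theorem wedgeSix_swap34 : wedgeSix a b c e d f = -wedgeSix a b c d e f :=
  wedgeSix_swap (show (3 : Fin 6) ≠ 4 by decide) (by funext k; fin_cases k <;> rfl)

end

theorem wedgeSix_eq_zero {i j : Fin 6} (hij : i ≠ j) {a b c d e f : Fin 6 → ℝ}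
    (h : ![a, b, c, d, e, f] i = ![a, b, c, d, e, f] j) : wedgeSix a b c d e f = 0 :=
  Matrix.det_zero_of_row_eq hij h

theorem sum_perm_two (a b c d e f : Fin 6 → ℝ) :
    ∑ σ : Equiv.Perm (Fin 6), ((Equiv.Perm.sign σ : ℤ) : ℝ) *
      (wedgeTwo a b (σ 0) (σ 1) * (c (σ 2) * d (σ 3)) * (e (σ 4) * f (σ 5))) =
        2 * wedgeSix a b c d e f := by
  have h : ∀ σ : Equiv.Perm (Fin 6), ((Equiv.Perm.sign σ : ℤ) : ℝ) *
      (wedgeTwo a b (σ 0) (σ 1) * (c (σ 2) * d (σ 3)) * (e (σ 4) * f (σ 5))) =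
        ((Equiv.Perm.sign σ : ℤ) : ℝ) *
            (a (σ 0) * b (σ 1) * (c (σ 2) * d (σ 3)) * (e (σ 4) * f (σ 5))) -
          ((Equiv.Perm.sign σ : ℤ) : ℝ) *
            (b (σ 0) * a (σ 1) * (c (σ 2) * d (σ 3)) * (e (σ 4) * f (σ 5))) := by
    intro σ
    rw [wedgeTwo]
    ring
  rw [Finset.sum_congr rfl fun σ _ => h σ, Finset.sum_sub_distrib, sum_perm_six, sum_perm_six,
    wedgeSix_swap01]
  ring

theorem sum_perm_two_two_two (a b c d e f : Fin 6 → ℝ) :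
    ∑ σ : Equiv.Perm (Fin 6), ((Equiv.Perm.sign σ : ℤ) : ℝ) *
      (wedgeTwo a b (σ 0) (σ 1) * wedgeTwo c d (σ 2) (σ 3) * wedgeTwo e f (σ 4) (σ 5)) =
        8 * wedgeSix a b c d e f := by
  have h : ∀ σ : Equiv.Perm (Fin 6), ((Equiv.Perm.sign σ : ℤ) : ℝ) *
      (wedgeTwo a b (σ 0) (σ 1) * wedgeTwo c d (σ 2) (σ 3) * wedgeTwo e f (σ 4) (σ 5)) =
        ((Equiv.Perm.sign σ : ℤ) : ℝ) *
            (wedgeTwo a b (σ 0) (σ 1) * (c (σ 2) * d (σ 3)) * (e (σ 4) * f (σ 5))) -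
          ((Equiv.Perm.sign σ : ℤ) : ℝ) *
            (wedgeTwo a b (σ 0) (σ 1) * (d (σ 2) * c (σ 3)) * (e (σ 4) * f (σ 5))) -
          ((Equiv.Perm.sign σ : ℤ) : ℝ) *
            (wedgeTwo a b (σ 0) (σ 1) * (c (σ 2) * d (σ 3)) * (f (σ 4) * e (σ 5))) +
          ((Equiv.Perm.sign σ : ℤ) : ℝ) *
            (wedgeTwo a b (σ 0) (σ 1) * (d (σ 2) * c (σ 3)) * (f (σ 4) * e (σ 5))) := by
    intro σ
    rw [wedgeTwo, wedgeTwo, wedgeTwo]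
    ring
  rw [Finset.sum_congr rfl fun σ _ => h σ]
  simp only [Finset.sum_add_distrib, Finset.sum_sub_distrib, sum_perm_two]
  rw [wedgeSix_swap45 a b d c e f, wedgeSix_swap45 a b c d e f, wedgeSix_swap23 a b c d e f]
  ring

/-- Antisymmetrizing the last four arguments first does not change the antisymmetrization. -/
theorem sum_perm_alternate (B : Fin 6 → Fin 6 → ℝ) (C : (Fin 4 → Fin 6) → ℝ) :
    ∑ σ : Equiv.Perm (Fin 6), ((Equiv.Perm.sign σ : ℤ) : ℝ) * (B (σ 0) (σ 1) *
      ∑ τ : Equiv.Perm (Fin 4), ((Equiv.Perm.sign τ : ℤ) : ℝ) *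
        C fun i => ![σ 2, σ 3, σ 4, σ 5] (τ i)) =
      24 * ∑ σ : Equiv.Perm (Fin 6), ((Equiv.Perm.sign σ : ℤ) : ℝ) *
        (B (σ 0) (σ 1) * C ![σ 2, σ 3, σ 4, σ 5]) := by
  have hvec : ∀ σ : Equiv.Perm (Fin 6), ![σ 2, σ 3, σ 4, σ 5] = fun i => σ (Fin.natAdd 2 i) := by
    intro σ
    funext i
    fin_cases i <;> rfl
  -- The permutation which fixes the first two places and applies τ to the last four.
  let emb : Equiv.Perm (Fin 4) → Equiv.Perm (Fin 6) := fun τ =>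
    (finSumFinEquiv (m := 2) (n := 4)).permCongr (Equiv.Perm.sumCongr 1 τ)
  have hsign : ∀ τ, Equiv.Perm.sign (emb τ) = Equiv.Perm.sign τ := by
    intro τ
    simp [emb, Equiv.Perm.sign_permCongr, Equiv.Perm.sign_sumCongr]
  have he : ∀ τ (x : Fin 2 ⊕ Fin 4),
      emb τ (finSumFinEquiv x) = finSumFinEquiv (Equiv.Perm.sumCongr 1 τ x) := by
    intro τ x
    simp only [emb, Equiv.permCongr_apply, Equiv.symm_apply_apply]
  have h0 : ∀ τ, emb τ 0 = 0 := fun τ => he τ (Sum.inl 0)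
  have h1 : ∀ τ, emb τ 1 = 1 := fun τ => he τ (Sum.inl 1)
  have h2 : ∀ τ (i : Fin 4), emb τ (Fin.natAdd 2 i) = Fin.natAdd 2 (τ i) := fun τ i =>
    he τ (Sum.inr i)
  have key : ∀ τ : Equiv.Perm (Fin 4),
      ∑ σ : Equiv.Perm (Fin 6), ((Equiv.Perm.sign σ : ℤ) : ℝ) * (B (σ 0) (σ 1) *
        (((Equiv.Perm.sign τ : ℤ) : ℝ) * C fun i => σ (Fin.natAdd 2 (τ i)))) =
      ∑ σ : Equiv.Perm (Fin 6), ((Equiv.Perm.sign σ : ℤ) : ℝ) *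
        (B (σ 0) (σ 1) * C fun i => σ (Fin.natAdd 2 i)) := by
    intro τ
    -- Reindexing σ by σ · (1 ⊕ τ) absorbs the sign of τ; each of the 4! = 24 permutations τ
    -- contributes equally.
    refine Fintype.sum_equiv (Equiv.mulRight (emb τ)) _ _ fun σ => ?_
    simp only [Equiv.coe_mulRight, Equiv.Perm.mul_apply, h0, h1, h2, Equiv.Perm.sign_mul, hsign]
    push_cast
    ring
  simp only [hvec, Finset.mul_sum]
  rw [Finset.sum_comm]
  rw [Finset.sum_congr rfl fun τ _ => key τ, Finset.sum_const, Finset.card_univ, Fintype.card_perm,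
    nsmul_eq_mul, Fintype.card_fin, Finset.mul_sum]
  norm_num [Nat.factorial]

/-! ### The form `ψ` in an adapted frame -/

/-- Compressing to the complement of the line kills the off-diagonal anticommutator. -/
theorem vertical_frameTangent {g : CMat} (h1 : gᴴ * g = 1) (y : Fin 3 → ℝ) (u : Fin 4 → ℝ)
    (a : Fin 3 → Fin 3 → ℝ) (D : Fin 3 → ℝ) :
    vertical (proj (framePoint g y)) (proj (frameTangent g y u a D)) = stdLambda g D := by
  show (1 - g * Matrix.diagonal ![1, 0, 0] * gᴴ) *
    (stdLambda g D - anticomm (stdLambda g y) (stdTangent g u)) *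
    (1 - g * Matrix.diagonal ![1, 0, 0] * gᴴ) = _
  have h2 : (1 : CMat) - g * Matrix.diagonal ![1, 0, 0] * gᴴ =
      g * (1 - Matrix.diagonal ![1, 0, 0]) * gᴴ := by
    rw [mul_sub, sub_mul, mul_one, mul_eq_one_comm.1 h1]
  rw [h2, anticomm_std h1, stdLambda_eq, ← sub_mul, ← mul_sub, conj_mul_conj h1, conj_mul_conj h1]
  congr 2
  have h3 : (1 : CMat) - Matrix.diagonal ![1, 0, 0] = Matrix.diagonal ![0, 1, 1] := by
    rw [← Matrix.diagonal_one, Matrix.diagonal_sub]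
    congr 1
    ext i
    fin_cases i <;> simp
  rw [h3]
  ext i j
  rw [Matrix.mul_diagonal, Matrix.diagonal_mul, Matrix.sub_apply]
  simp only [anticomm, Matrix.add_apply, Matrix.mul_apply, Fin.sum_univ_three]
  fin_cases i <;> fin_cases j <;> simp [pauli, baseTangent]

/-- The metric is 4 |u|² in these coordinates, so the volume form is 16 times the determinant. -/
theorem fsVolume_std {g : CMat} (h1 : gᴴ * g = 1) (u : Fin 4 → Fin 4 → ℝ) :
    fsVolume (g * Matrix.diagonal ![1, 0, 0] * gᴴ) (fun i => stdTangent g (u i)) =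
      ∑ τ : Equiv.Perm (Fin 4), ((Equiv.Perm.sign τ : ℤ) : ℝ) *
        (16 * (u (τ 0) 0 * u (τ 1) 1 * (u (τ 2) 2 * u (τ 3) 3))) := by
  have h : ∑ τ : Equiv.Perm (Fin 4), ((Equiv.Perm.sign τ : ℤ) : ℝ) *
      (16 * (u (τ 0) 0 * u (τ 1) 1 * (u (τ 2) 2 * u (τ 3) 3))) = 16 * (Matrix.of u).det := by
    rw [Matrix.det_apply', Finset.mul_sum]
    refine Finset.sum_congr rfl fun τ _ => ?_
    simp only [Fin.prod_univ_four, Matrix.of_apply]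
    ring
  rw [h]
  simp only [fsVolume, fsKahler_std h1]
  simp [Matrix.det_succ_row_zero, Fin.sum_univ_succ, Fin.succAbove]
  ring

theorem bsPsi_frameTangent {g : CMat} (h1 : gᴴ * g = 1) (y : Fin 3 → ℝ) (u : Fin 4 → Fin 4 → ℝ)
    (a : Fin 4 → Fin 3 → Fin 3 → ℝ) (D : Fin 4 → Fin 3 → ℝ) :
    bsPsi (proj (framePoint g y)) (fun i => proj (frameTangent g y (u i) (a i) (D i))) =
      ∑ τ : Equiv.Perm (Fin 4), ((Equiv.Perm.sign τ : ℤ) : ℝ) *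
        (16 * (1 + (y 0 ^ 2 + y 1 ^ 2 + y 2 ^ 2)) *
            (u (τ 0) 0 * u (τ 1) 1 * (u (τ 2) 2 * u (τ 3) 3)) +
          ((D (τ 0) 1 * D (τ 1) 2 - D (τ 0) 2 * D (τ 1) 1) * asdBasis (u (τ 2)) (u (τ 3)) 0 +
            (D (τ 0) 2 * D (τ 1) 0 - D (τ 0) 0 * D (τ 1) 2) * asdBasis (u (τ 2)) (u (τ 3)) 1 +
            (D (τ 0) 0 * D (τ 1) 1 - D (τ 0) 1 * D (τ 1) 0) * asdBasis (u (τ 2)) (u (τ 3)) 2)) := by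
  have hr : radiusSq (proj (framePoint g y)) = y 0 ^ 2 + y 1 ^ 2 + y 2 ^ 2 := by
    rw [radiusSq_eq]
    show pairing (stdLambda g y) (stdLambda g y) = _
    rw [pairing_lambda h1]
    ring
  have hv : fsVolume (proj (framePoint g y)).1
      (fun i => (proj (frameTangent g y (u i) (a i) (D i))).1) = _ := fsVolume_std h1 u
  have ha : ∀ (D D' : Fin 3 → ℝ) (u u' : Fin 4 → ℝ),
      asdForm (cross (stdLambda g D) (stdLambda g D')) (stdTangent g u) (stdTangent g u') =
        4 * ((D 1 * D' 2 - D 2 * D' 1) * asdBasis u u' 0 +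
          (D 2 * D' 0 - D 0 * D' 2) * asdBasis u u' 1 +
          (D 0 * D' 1 - D 1 * D' 0) * asdBasis u u' 2) := by
    intro D D' u u'
    rw [cross_std h1, asdForm_std h1]
    simp [asdBasis]
  have ht : ∀ i, (proj (frameTangent g y (u i) (a i) (D i))).1 = stdTangent g (u i) := fun _ => rfl
  rw [bsPsi, hr, hv, Finset.mul_sum, Finset.mul_sum, ← Finset.sum_add_distrib]
  refine Finset.sum_congr rfl fun τ _ => ?_
  simp only [vertical_frameTangent h1, ht, ha]
  ring

/-! ### Vanishing and reordering of sixfold wedge products. -/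

theorem wedgeSix_self02 (a b d e f : Fin 6 → ℝ) : wedgeSix a b a d e f = 0 :=
  wedgeSix_eq_zero (show (0 : Fin 6) ≠ 2 by decide) rfl

theorem wedgeSix_self03 (a b c e f : Fin 6 → ℝ) : wedgeSix a b c a e f = 0 :=
  wedgeSix_eq_zero (show (0 : Fin 6) ≠ 3 by decide) rfl

theorem wedgeSix_self04 (a b c d f : Fin 6 → ℝ) : wedgeSix a b c d a f = 0 :=
  wedgeSix_eq_zero (show (0 : Fin 6) ≠ 4 by decide) rfl

theorem wedgeSix_self05 (a b c d e : Fin 6 → ℝ) : wedgeSix a b c d e a = 0 :=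
  wedgeSix_eq_zero (show (0 : Fin 6) ≠ 5 by decide) rfl

theorem wedgeSix_self12 (a b d e f : Fin 6 → ℝ) : wedgeSix a b b d e f = 0 :=
  wedgeSix_eq_zero (show (1 : Fin 6) ≠ 2 by decide) rfl

theorem wedgeSix_self14 (a b c d f : Fin 6 → ℝ) : wedgeSix a b c d b f = 0 :=
  wedgeSix_eq_zero (show (1 : Fin 6) ≠ 4 by decide) rfl

theorem wedgeSix_self15 (a b c d e : Fin 6 → ℝ) : wedgeSix a b c d e b = 0 :=
  wedgeSix_eq_zero (show (1 : Fin 6) ≠ 5 by decide) rfl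

theorem wedgeSix_blocks (a b c d e f : Fin 6 → ℝ) :
    wedgeSix a b c d e f = wedgeSix c d a b e f := by
  rw [wedgeSix_swap12 a c b, wedgeSix_swap01 c a, wedgeSix_swap23 c a d b, wedgeSix_swap12 c d a]
  ring

theorem wedgeSix_rotate (a b c d e f : Fin 6 → ℝ) :
    wedgeSix a b c f d e = wedgeSix a b c d e f := by
  rw [wedgeSix_swap34 a b c d f, wedgeSix_swap45 a b c d e f]
  ring

theorem wedgeSix_last_blocks (a b c d e f : Fin 6 → ℝ) :
    wedgeSix a b e f c d = wedgeSix a b c d e f := by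
  rw [wedgeSix_swap34 a b e c f, wedgeSix_swap23 a b c e f, wedgeSix_swap45 a b c e d f,
    wedgeSix_swap34 a b c d e]
  ring

/-- `ψ` in an adapted frame, before antisymmetrization; `U` and `V` are the horizontal and vertical
coordinates of six vectors, and `r = 1 + s²`. -/
noncomputable def psiDensity (r : ℝ) (U : Fin 4 → Fin 6 → ℝ) (V : Fin 3 → Fin 6 → ℝ)
    (i j k l : Fin 6) : ℝ :=
  16 * r * (U 0 i * U 1 j * (U 2 k * U 3 l)) +
    (wedgeTwo (V 1) (V 2) i j * (-wedgeTwo (U 0) (U 1) k l + wedgeTwo (U 2) (U 3) k l) +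
      wedgeTwo (V 2) (V 0) i j * (-wedgeTwo (U 0) (U 3) k l + wedgeTwo (U 1) (U 2) k l) +
      wedgeTwo (V 0) (V 1) i j * (wedgeTwo (U 0) (U 2) k l - wedgeTwo (U 3) (U 1) k l))

theorem sum_wedgeTwo_psiDensity (a b : Fin 6 → ℝ) (r : ℝ) (U : Fin 4 → Fin 6 → ℝ)
    (V : Fin 3 → Fin 6 → ℝ) :
    ∑ σ : Equiv.Perm (Fin 6), ((Equiv.Perm.sign σ : ℤ) : ℝ) *
      (wedgeTwo a b (σ 0) (σ 1) * psiDensity r U V (σ 2) (σ 3) (σ 4) (σ 5)) =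
      16 * r * (2 * wedgeSix a b (U 0) (U 1) (U 2) (U 3)) +
        (8 * wedgeSix a b (V 1) (V 2) (U 2) (U 3) - 8 * wedgeSix a b (V 1) (V 2) (U 0) (U 1) +
          (8 * wedgeSix a b (V 2) (V 0) (U 1) (U 2) - 8 * wedgeSix a b (V 2) (V 0) (U 0) (U 3)) +
          (8 * wedgeSix a b (V 0) (V 1) (U 0) (U 2) - 8 * wedgeSix a b (V 0) (V 1) (U 3) (U 1))) := by
  simp only [← sum_perm_two, ← sum_perm_two_two_two, Finset.mul_sum, ← Finset.sum_add_distrib,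
    ← Finset.sum_sub_distrib]
  refine Finset.sum_congr rfl fun σ _ => ?_
  rw [psiDensity]
  ring

/-- The wedge product of each of the three 2-forms `instantonTwoForm` with `ψ` vanishes. -/
theorem sum_instantonTwoForm_psiDensity {r : ℝ} (hr : r ≠ 0) (U : Fin 4 → Fin 6 → ℝ)
    (V : Fin 3 → Fin 6 → ℝ) (θ : Fin 3 → Fin 6 → Fin 6 → ℝ)
    (h0 : ∀ i j, θ 0 i j = 2 * (-wedgeTwo (U 0) (U 1) i j + wedgeTwo (U 2) (U 3) i j) +
      wedgeTwo (V 1) (V 2) i j / r)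
    (h1 : ∀ i j, θ 1 i j = 2 * (-wedgeTwo (U 0) (U 3) i j + wedgeTwo (U 1) (U 2) i j) +
      wedgeTwo (V 2) (V 0) i j / r)
    (h2 : ∀ i j, θ 2 i j = 2 * (wedgeTwo (U 0) (U 2) i j - wedgeTwo (U 3) (U 1) i j) +
      wedgeTwo (V 0) (V 1) i j / r) (m : Fin 3) :
    ∑ σ : Equiv.Perm (Fin 6), ((Equiv.Perm.sign σ : ℤ) : ℝ) *
      (θ m (σ 0) (σ 1) * psiDensity r U V (σ 2) (σ 3) (σ 4) (σ 5)) = 0 := by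
  -- By linearity only wedges of ψ with decomposable 2-forms are needed.
  have hlin : ∀ (a b c d e f : Fin 6 → ℝ) (s t : ℝ) (η : Fin 6 → Fin 6 → ℝ),
      (∀ i j, η i j = s * wedgeTwo a b i j + t * wedgeTwo c d i j + r⁻¹ * wedgeTwo e f i j) →
      ∑ σ : Equiv.Perm (Fin 6), ((Equiv.Perm.sign σ : ℤ) : ℝ) *
        (η (σ 0) (σ 1) * psiDensity r U V (σ 2) (σ 3) (σ 4) (σ 5)) =
      s * ∑ σ : Equiv.Perm (Fin 6), ((Equiv.Perm.sign σ : ℤ) : ℝ) *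
          (wedgeTwo a b (σ 0) (σ 1) * psiDensity r U V (σ 2) (σ 3) (σ 4) (σ 5)) +
        t * ∑ σ : Equiv.Perm (Fin 6), ((Equiv.Perm.sign σ : ℤ) : ℝ) *
          (wedgeTwo c d (σ 0) (σ 1) * psiDensity r U V (σ 2) (σ 3) (σ 4) (σ 5)) +
        r⁻¹ * ∑ σ : Equiv.Perm (Fin 6), ((Equiv.Perm.sign σ : ℤ) : ℝ) *
          (wedgeTwo e f (σ 0) (σ 1) * psiDensity r U V (σ 2) (σ 3) (σ 4) (σ 5)) := by
    intro a b c d e f s t η hη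
    simp only [Finset.mul_sum, ← Finset.sum_add_distrib]
    refine Finset.sum_congr rfl fun σ _ => ?_
    rw [hη]
    ring
  fin_cases m
  · refine (hlin (U 0) (U 1) (U 2) (U 3) (V 1) (V 2) (-2) 2 (θ 0) fun i j => ?_).trans ?_
    · rw [h0]; ring
    -- Repeated covectors remove all mixed products. Of the survivors, the two halves of Ω₁
    -- contribute -16 each and the vertical term 32 r · r⁻¹, all times the same sixfold wedge.
    · simp only [sum_wedgeTwo_psiDensity, wedgeSix_self02, wedgeSix_self03, wedgeSix_self04,
        wedgeSix_self05, wedgeSix_self12, wedgeSix_self14, wedgeSix_self15]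
      rw [wedgeSix_blocks (U 0) (U 1) (V 1) (V 2), wedgeSix_blocks (U 2) (U 3) (V 1) (V 2),
        wedgeSix_last_blocks (V 1) (V 2) (U 0) (U 1)]
      field_simp
      ring
  · refine (hlin (U 0) (U 3) (U 1) (U 2) (V 2) (V 0) (-2) 2 (θ 1) fun i j => ?_).trans ?_
    · rw [h1]; ring
    · simp only [sum_wedgeTwo_psiDensity, wedgeSix_self02, wedgeSix_self03, wedgeSix_self04,
        wedgeSix_self05, wedgeSix_self12, wedgeSix_self14, wedgeSix_self15]
      rw [wedgeSix_blocks (U 0) (U 3) (V 2) (V 0), wedgeSix_blocks (U 1) (U 2) (V 2) (V 0),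
        wedgeSix_last_blocks (V 2) (V 0) (U 0) (U 3), wedgeSix_rotate (V 2) (V 0) (U 0) (U 1)]
      field_simp
      ring
  · refine (hlin (U 0) (U 2) (U 3) (U 1) (V 0) (V 1) 2 (-2) (θ 2) fun i j => ?_).trans ?_
    · rw [h2]; ring
    · simp only [sum_wedgeTwo_psiDensity, wedgeSix_self02, wedgeSix_self03, wedgeSix_self04,
        wedgeSix_self05, wedgeSix_self12, wedgeSix_self14, wedgeSix_self15]
      rw [wedgeSix_blocks (U 0) (U 2) (V 0) (V 1), wedgeSix_blocks (U 3) (U 1) (V 0) (V 1),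
        wedgeSix_last_blocks (V 0) (V 1) (U 0) (U 2), wedgeSix_rotate (V 0) (V 1) (U 0) (U 3),
        wedgeSix_rotate (V 0) (V 1) (U 0) (U 1)]
      field_simp
      ring

/-- The curvature of `conn` in an adapted frame depends linearly on the three 2-forms. -/
theorem exists_hat_eq (c d : ℝ) (y : Fin 3 → ℝ) (i j : Fin 3) : ∃ k : Fin 3 → ℝ, ∀ x : Fin 3 → ℝ,
    hat (fun m => c * x m + d * (y 0 * x 0 + y 1 * x 1 + y 2 * x 2) * y m) i j =
      k 0 * x 0 + k 1 * x 1 + k 2 * x 2 := by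
  -- The coefficients are the values on the standard basis vectors.
  refine ⟨fun l => hat (fun m => (if m = l then c else 0) + d * y l * y m) i j, fun x => ?_⟩
  fin_cases i <;> fin_cases j <;> simp [hat] <;> ring

theorem isG2Instanton_conn : IsG2Instanton conn := by
  intro p hp v hv
  obtain ⟨g, y, hg, rfl⟩ := exists_framePoint hp
  choose u a D ha hvD using fun i => exists_frameTangent hg (hv i)
  obtain rfl : v = fun i => frameTangent g y (u i) (a i) (D i) := funext hvD
  set N := y 0 ^ 2 + y 1 ^ 2 + y 2 ^ 2 with hN
  have hr : 1 + N ≠ 0 := by positivity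
  set U : Fin 4 → Fin 6 → ℝ := fun k i => u i k
  set V : Fin 3 → Fin 6 → ℝ := fun k i => D i k
  set θ : Fin 3 → Fin 6 → Fin 6 → ℝ :=
    fun m i j => instantonTwoForm y (u i) (u j) (D i) (D j) m with hθ
  have hψ : ∀ σ : Equiv.Perm (Fin 6),
      bsPsi (proj (framePoint g y))
        ![proj (frameTangent g y (u (σ 2)) (a (σ 2)) (D (σ 2))),
          proj (frameTangent g y (u (σ 3)) (a (σ 3)) (D (σ 3))),
          proj (frameTangent g y (u (σ 4)) (a (σ 4)) (D (σ 4))),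
          proj (frameTangent g y (u (σ 5)) (a (σ 5)) (D (σ 5)))] =
      ∑ τ : Equiv.Perm (Fin 4), ((Equiv.Perm.sign τ : ℤ) : ℝ) *
        psiDensity (1 + N) U V (![σ 2, σ 3, σ 4, σ 5] (τ 0)) (![σ 2, σ 3, σ 4, σ 5] (τ 1))
          (![σ 2, σ 3, σ 4, σ 5] (τ 2)) (![σ 2, σ 3, σ 4, σ 5] (τ 3)) := by
    intro σ
    have h := bsPsi_frameTangent hg y (fun i => u (![σ 2, σ 3, σ 4, σ 5] i))
      (fun i => a (![σ 2, σ 3, σ 4, σ 5] i)) (fun i => D (![σ 2, σ 3, σ 4, σ 5] i))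
    refine Eq.trans (congrArg _ ?_) (h.trans ?_)
    · funext i
      fin_cases i <;> rfl
    · refine Finset.sum_congr rfl fun τ _ => ?_
      congr 1
      simp [psiDensity, wedgeTwo, asdBasis, U, V, hN]
      ring
  have hX : ∀ m, ∑ σ : Equiv.Perm (Fin 6), ((Equiv.Perm.sign σ : ℤ) : ℝ) *
      (θ m (σ 0) (σ 1) * ∑ τ : Equiv.Perm (Fin 4), ((Equiv.Perm.sign τ : ℤ) : ℝ) *
        psiDensity (1 + N) U V (![σ 2, σ 3, σ 4, σ 5] (τ 0)) (![σ 2, σ 3, σ 4, σ 5] (τ 1))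
          (![σ 2, σ 3, σ 4, σ 5] (τ 2)) (![σ 2, σ 3, σ 4, σ 5] (τ 3))) = 0 := by
    intro m
    refine (sum_perm_alternate (θ m)
      fun t => psiDensity (1 + N) U V (t 0) (t 1) (t 2) (t 3)).trans ?_
    refine mul_eq_zero_of_right _ (sum_instantonTwoForm_psiDensity hr U V θ ?_ ?_ ?_ m)
    all_goals
      intro i j
      simp [hθ, instantonTwoForm, asdBasis, wedgeTwo, U, V, hN]
      ring
  ext i j
  -- The coefficients depend on the point but not on the vectors, so they come out of the sum over
  -- permutations.
  obtain ⟨k, hk⟩ := exists_hat_eq (1 - N * profile N) (profile N) y i j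
  have hF : ∀ l m, curvature conn (framePoint g y) (frameTangent g y (u l) (a l) (D l))
      (frameTangent g y (u m) (a m) (D m)) i j =
      k 0 * θ 0 l m + k 1 * θ 1 l m + k 2 * θ 2 l m := by
    intro l m
    rw [curvature_conn hg y _ _ (ha _) (ha _)]
    exact hk fun n => θ n l m
  simp only [curvatureWedgePsi, Matrix.smul_apply, Matrix.sum_apply, hψ, hF, smul_eq_mul,
    Matrix.zero_apply]
  refine mul_eq_zero_of_right _ ?_
  have h := congrArg₂ (· + ·) (congrArg₂ (· + ·) (congrArg (k 0 * ·) (hX 0))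
    (congrArg (k 1 * ·) (hX 1))) (congrArg (k 2 * ·) (hX 2))
  simp only [mul_zero, add_zero] at h
  rw [← h]
  simp only [Finset.mul_sum _ _ (k _), ← Finset.sum_add_distrib]
  refine Finset.sum_congr rfl fun σ _ => ?_
  ring

end BSInstanton

open BSInstanton

/-- For each sign `ε = ±1`, the bundle `P_{α₂}` extends to `P → X = Λ²₋(ℂℙ²)` (through `Φ`) so that
`α ⊗ T₁ + ε (1 + s²)^{-1/2} (ν₁ ⊗ T₂ + ν₂ ⊗ T₃)` extends to a smooth connection `A` on `P`, which is
an irreducible `G₂`-instanton with the stated curvature. -/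
theorem mainTheorem7 (ε : ℝ) (hε : ε = 1 ∨ ε = -1) :
    ∃ (Φ : ℝ × CMat → FrameSpace) (A : OneForm),
      IsExtension Φ ∧ IsConnection A ∧
      (∀ s > 0, ∀ g ∈ SU3, ∀ v : ℝ × CMat, v.2 ∈ tangentVectors SU3 g →
        A (Φ (s, g)) ![fderiv ℝ Φ (s, g) v] = instantonForm ε s g v) ∧
      IsIrreducibleConnection A ∧
      IsG2Instanton A ∧
      (∀ s > 0, ∀ g ∈ SU3, ∀ v w : ℝ × CMat,
        v.2 ∈ tangentVectors SU3 g → w.2 ∈ tangentVectors SU3 g →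
        curvature A (Φ (s, g)) (fderiv ℝ Φ (s, g) v) (fderiv ℝ Φ (s, g) w) =
          instantonCurvature ε s g v w) := by
  have h : ε * ε = 1 := by rcases hε with rfl | rfl <;> norm_num
  exact ⟨extensionMap ε, conn, isExtension_extensionMap h, isConnection_conn,
    fun s hs g hg v hv => conn_extensionMap h hg hs hv, isIrreducibleConnection_conn,
    isG2Instanton_conn, fun s hs g hg v w hv hw => curvature_extensionMap h hg hs hv hw⟩
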